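/- There is an absolute constant $C>0$ such that the following holds. Let $E$ be a real or complex Banach space, let $(x_n)_{n\ge 1}$ be a sequence in $E$, and let $(\varepsilon_n)$ be a Rademacher sequence on a probability space $(\Omega,\Sigma,P)$, i.e. a sequence of independent random variables with $P(\varepsilon_n=1)=P(\varepsilon_n=-1)=\frac12$. Suppose that the series $X=\sum_n\varepsilon_n x_n$ converges almost surely in the norm of $E$, put $S=\|X\|$, and let $S^*(t)=\inf\{s>0: P(S>s)\le t\}$ be the decreasing rearrangement of $S$. For a scalar sequence $a\in\ell_2$ and $u>0$ let $$K_{1,2}(a,u)=\inf\{\|b\|_1+u\|c\|_2 : a=b+c,\ b\in\ell_1,\ c\in\ell_2\},\qquad K^w_{1,2}((x_n),u)=\sup_{x^*\in E^*,\,\|x^*\|\le 1}K_{1,2}((x^*(x_n))_n,u).$$ Then $\mathbb E\|X\|<\infty$, $(x^*(x_n))_n\in\ell_2$ for every $x^*\in E^*$, and, for every $0<t\le\frac1{10}$, $K^w_{1,2}((x_n),\sqrt{\log(1/t)})<\infty$ and $$\frac1C\,S^*(t)\;\le\;\mathbb E\|X\|+K^w_{1,2}\bigl((x_n),\sqrt{\log(1/t)}\bigr)\;\le\;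 C\,S^*(t).$$ -/

import Mathlib

open MeasureTheory ProbabilityTheory Filter Topology
open scoped ENNReal

/-- A Rademacher sequence on a probability space: independent random variables, each taking the
values `1` and `-1` with probability `1/2`. -/
structure IsRademacherSeq {Ω : Type*} [MeasurableSpace Ω] (P : Measure Ω)
    (ε : ℕ → Ω → ℝ) : Prop where
  measurable : ∀ n, Measurable (ε n)
  indep : iIndepFun ε P
  prob_one : ∀ n, P {ω | ε n ω = 1} = 1 / 2
  prob_neg_one : ∀ n, P {ω | ε n ω = -1} = 1 / 2

/-- `X` is the sum of the almost surely (norm-)convergent series `∑ εₙ xₙ`. -/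
def IsASSum {𝕜 E Ω : Type*} [RCLike 𝕜] [NormedAddCommGroup E] [NormedSpace 𝕜 E]
    [MeasurableSpace Ω] (P : Measure Ω) (ε : ℕ → Ω → ℝ) (x : ℕ → E) (X : Ω → E) : Prop :=
  ∀ᵐ ω ∂P, Tendsto (fun N : ℕ => ∑ n ∈ Finset.range N, (ε n ω : 𝕜) • x n) atTop (𝓝 (X ω))

/-- The decreasing rearrangement `Y*(t) = inf {s > 0 : P(|Y| > s) ≤ t}`. -/
noncomputable def decreasingRearrangement {Ω : Type*} [MeasurableSpace Ω] (P : Measure Ω)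
    (Y : Ω → ℝ) (t : ℝ) : ℝ :=
  sInf {s : ℝ | 0 < s ∧ P.real {ω | s < |Y ω|} ≤ t}

/-- The `K`-functional of the couple `(ℓ₁, ℓ₂)` of scalar sequences:
`K₁,₂(a, t) = inf {‖b‖₁ + t ‖c‖₂ : a = b + c, b ∈ ℓ₁, c ∈ ℓ₂}`. -/
noncomputable def K12 {𝕜 : Type*} [RCLike 𝕜] (a : ℕ → 𝕜) (t : ℝ) : ℝ :=
  sInf {r : ℝ | ∃ (b : lp (fun _ : ℕ => 𝕜) 1) (c : lp (fun _ : ℕ => 𝕜) 2),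
    (∀ n, a n = b n + c n) ∧ r = ‖b‖ + t * ‖c‖}

/-- A sequence in a Banach space is weakly-`ℓ_p` if its image under every continuous linear
functional belongs to `ℓ_p`. -/
def WeaklyMemlp (𝕜 : Type*) {E : Type*} [RCLike 𝕜] [NormedAddCommGroup E] [NormedSpace 𝕜 E]
    (p : ℝ≥0∞) (x : ℕ → E) : Prop :=
  ∀ f : StrongDual 𝕜 E, Memℓp (fun n => f (x n)) p

/-- The set of values `K₁,₂((x*(xₙ)), t)`, for `x*` in the closed unit ball of the dual. -/
def weakK12Set (𝕜 : Type*) {E : Type*} [RCLike 𝕜] [NormedAddCommGroup E] [NormedSpace 𝕜 E]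
    (x : ℕ → E) (t : ℝ) : Set ℝ :=
  {r : ℝ | ∃ f : StrongDual 𝕜 E, ‖f‖ ≤ 1 ∧ r = K12 (fun n => f (x n)) t}

/-- `K^w₁,₂((xₙ), t) = sup_{‖x*‖ ≤ 1} K₁,₂((x*(xₙ)), t)`. -/
noncomputable def weakK12 (𝕜 : Type*) {E : Type*} [RCLike 𝕜] [NormedAddCommGroup E]
    [NormedSpace 𝕜 E] (x : ℕ → E) (t : ℝ) : ℝ :=
  sSup (weakK12Set 𝕜 x t)

/-!
Write `S_N` for the norm of the partial sum `∑_{n < N} εₙ xₙ`, a function on the discrete cube with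
its uniform measure, and `u = √(log (1 / t))`. All estimates are proved for `S_N` and transferred
to `S = ‖X‖` by convergence in probability (`eventually_cubeProb_le`, `measureReal_norm_gt_le`) and
Fatou's lemma (`lintegral_enorm_le`).

Both directions use Talagrand's convex concentration inequality
(`exists_selection_cubeAvg_exp_le`): most points of the cube are at a bounded Euclidean distance
from any convex set that contains a fixed proportion of the sign vectors. If a sign vector `σ` is at
distance at most `4 u` from a point `y ∈ [-1, 1]^N` at which the norm is at most twice the mean of
`S_N`, then `σ - y` is bounded by `2` in `ℓ_∞` and by `4 u` in `ℓ₂`, so that every functional `x*`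
of the unit ball changes by at most `4 K₁,₂((x*(xₙ)), u)` between `y` and `σ`. This gives the bound
`P(S_N > 2 M + 4 K^w) ≤ 2 t²` for `M` above the mean (`cubeProb_radNorm_gt_le`), hence the estimate
of `S*(t)` from above.

For the estimate from below let `S_N ≤ s` hold with probability at least `1 - 2 t ≥ 4 / 5`. A
Paley–Zygmund argument with fourth moments bounds `‖(x*(xₙ))‖₂` by a multiple of `s`
(`sum_sq_le_of_cubeProb_le`), and convex concentration then bounds the mean of `S_N`
(`cubeAvg_radNorm_le`). For the `K`-functional, let `0 ≤ bₙ ≤ 1` and `‖b‖₂ ≤ u / 2`. Changing the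
measure by the Riesz product `∏ (1 + sgn(aₙ) bₙ εₙ)` moves the mean of a real Rademacher sum
`∑ εₙ aₙ` to `L = ∑ |aₙ| bₙ`. The variance stays at most `‖a‖₂²`, and the squared `L₂` norm of the
density is at most `exp (u² / 4)`. Hence if `L` is large compared with `s`, the sum exceeds `L / 2`
with probability at least `(9 / 16) t ^ (1 / 4) > 2 t`, which is impossible
(`exp_neg_le_cubeProb_radSum`, `sum_abs_mul_le_of_cubeProb_le`). A truncation of `a` shows that the
supremum of `L` over `b` dominates the `K`-functional (`exists_truncation`).
-/

/-! ### Averages over the discrete cube -/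

/-- The sign `±1` encoded by a Boolean. -/
def boolSign (b : Bool) : ℝ := if b then 1 else -1

@[simp] lemma boolSign_true : boolSign true = 1 := rfl

@[simp] lemma boolSign_false : boolSign false = -1 := rfl

lemma abs_boolSign (b : Bool) : |boolSign b| = 1 := by cases b <;> simp

/-- The average of a function over the discrete cube, encoded as `Fin n → Bool`. -/
noncomputable def cubeAvg {n : ℕ} (F : (Fin n → Bool) → ℝ) : ℝ := (∑ σ, F σ) / 2 ^ n

open Classical in
/-- The proportion of the points of the discrete cube that satisfy `p`. -/
noncomputable def cubeProb {n : ℕ} (p : (Fin n → Bool) → Prop) : ℝ :=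
  cubeAvg fun σ => if p σ then 1 else 0

lemma cubeAvg_zero (F : (Fin 0 → Bool) → ℝ) : cubeAvg F = F default := by
  rw [cubeAvg, Fintype.sum_unique, pow_zero, div_one]
  exact congrArg F (Subsingleton.elim _ _)

lemma cubeAvg_succ {n : ℕ} (F : (Fin (n + 1) → Bool) → ℝ) :
    cubeAvg F = (cubeAvg (fun σ => F (Fin.cons true σ)) +
      cubeAvg (fun σ => F (Fin.cons false σ))) / 2 := by
  unfold cubeAvg
  have h : ∑ σ, F σ = ∑ b : Bool, ∑ σ : Fin n → Bool, F (Fin.cons b σ) := by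
    rw [← Fintype.sum_prod_type' (f := fun (b : Bool) (σ : Fin n → Bool) => F (Fin.cons b σ))]
    exact (Fintype.sum_equiv (Fin.consEquiv (fun _ => Bool)) _ _ (fun _ => rfl)).symm
  rw [h, Fintype.sum_bool, pow_succ]
  field_simp

lemma cubeAvg_mono {n : ℕ} {F G : (Fin n → Bool) → ℝ} (h : ∀ σ, F σ ≤ G σ) :
    cubeAvg F ≤ cubeAvg G := by
  unfold cubeAvg
  gcongr
  exact h _

lemma cubeAvg_add {n : ℕ} (F G : (Fin n → Bool) → ℝ) :
    cubeAvg (fun σ => F σ + G σ) = cubeAvg F + cubeAvg G := by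
  simp [cubeAvg, Finset.sum_add_distrib, add_div]

lemma cubeAvg_const_mul {n : ℕ} (c : ℝ) (F : (Fin n → Bool) → ℝ) :
    cubeAvg (fun σ => c * F σ) = c * cubeAvg F := by
  simp [cubeAvg, ← Finset.mul_sum, mul_div_assoc]

@[simp] lemma cubeAvg_const {n : ℕ} (c : ℝ) : cubeAvg (fun _ : Fin n → Bool => c) = c := by
  simp [cubeAvg]

lemma cubeAvg_nonneg {n : ℕ} {F : (Fin n → Bool) → ℝ} (h : ∀ σ, 0 ≤ F σ) : 0 ≤ cubeAvg F := by
  simpa using cubeAvg_mono h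

lemma cubeProb_nonneg {n : ℕ} (p : (Fin n → Bool) → Prop) : 0 ≤ cubeProb p :=
  cubeAvg_nonneg fun σ => by split_ifs <;> norm_num

lemma cubeProb_mono {n : ℕ} {p q : (Fin n → Bool) → Prop} (h : ∀ σ, p σ → q σ) :
    cubeProb p ≤ cubeProb q := by
  refine cubeAvg_mono fun σ => ?_
  by_cases hp : p σ
  · simp [hp, h σ hp]
  · simp only [hp, if_false]
    split_ifs <;> norm_num

lemma cubeProb_add_not {n : ℕ} (p : (Fin n → Bool) → Prop) :
    cubeProb p + cubeProb (fun σ => ¬ p σ) = 1 := by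
  unfold cubeProb
  rw [← cubeAvg_add]
  conv_rhs => rw [← cubeAvg_const (n := n) 1]
  congr 1
  funext σ
  by_cases h : p σ <;> simp [h]

/-- Markov's inequality on the cube. -/
lemma mul_cubeProb_le {n : ℕ} {F : (Fin n → Bool) → ℝ} (hF : ∀ σ, 0 ≤ F σ) (s : ℝ)
    (p : (Fin n → Bool) → Prop) (hp : ∀ σ, p σ → s ≤ F σ) : s * cubeProb p ≤ cubeAvg F := by
  unfold cubeProb
  rw [← cubeAvg_const_mul]
  refine cubeAvg_mono fun σ => ?_
  by_cases h : p σ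
  · simpa [h] using hp σ h
  · simpa [h] using hF σ

lemma exists_of_cubeProb_pos {n : ℕ} {p : (Fin n → Bool) → Prop} (h : 0 < cubeProb p) :
    ∃ σ, p σ := by
  by_contra! hn
  simp [cubeProb, hn] at h

lemma cubeAvg_mul_sq_le {n : ℕ} (F G : (Fin n → Bool) → ℝ) :
    cubeAvg (fun σ => F σ * G σ) ^ 2 ≤ cubeAvg (fun σ => F σ ^ 2) * cubeAvg (fun σ => G σ ^ 2) := by
  unfold cubeAvg
  rw [div_pow, div_mul_div_comm, ← sq]
  gcongr
  exact Finset.sum_mul_sq_le_sq_mul_sq _ _ _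

/-! ### Convex concentration on the cube -/

/-- The two-point inequality behind the induction step of Talagrand's inequality: the minority
face of relative size `r` is reached with the interpolation parameter `1 - r`. -/
lemma one_add_exp_mul_rpow_le {r : ℝ} (h0 : 0 < r) (h1 : r ≤ 1) :
    1 + Real.exp ((1 - r) ^ 2 / 2) * r ^ (-r) ≤ 4 / (1 + r) := by
  have hlog : -(r * Real.log r) ≤ (1 - r ^ 2) / 2 := by
    have h := Real.log_le_sub_one_of_pos (x := r⁻¹) (by positivity)
    -- `log y ≤ (y - y⁻¹) / 2` for `y = r⁻¹ ≥ 1`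
    have hs : Real.log r⁻¹ ≤ Real.sinh (Real.log r⁻¹) :=
      Real.self_le_sinh_iff.2 (Real.log_nonneg ((one_le_inv₀ h0).2 h1))
    rw [Real.sinh_eq, Real.exp_neg, Real.exp_log (by positivity), inv_inv, Real.log_inv] at hs
    have := mul_le_mul_of_nonneg_left hs h0.le
    have e : r * ((r⁻¹ - r) / 2) = (1 - r ^ 2) / 2 := by field_simp
    linarith
  have hexp : Real.exp (1 - r) ≤ (3 - r) / (1 + r) := by
    have h := Real.sum_range_le_log_div (x := (1 - r) / 2) (by linarith) (by linarith) 1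
    have e : (1 + (1 - r) / 2) / (1 - (1 - r) / 2) = (3 - r) / (1 + r) := by
      have h2 : 1 - (1 - r) / 2 = (1 + r) / 2 := by ring
      rw [h2, div_eq_div_iff (by positivity) (by positivity)]
      ring
    rw [e] at h
    have hpos : 0 < (3 - r) / (1 + r) := div_pos (by linarith) (by linarith)
    rw [← Real.le_log_iff_exp_le hpos]
    simp at h
    linarith
  have : Real.exp ((1 - r) ^ 2 / 2) * r ^ (-r) ≤ Real.exp (1 - r) := by
    rw [Real.rpow_def_of_pos h0, ← Real.exp_add]
    apply Real.exp_le_exp.2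
    nlinarith
  have e2 : 4 / (1 + r) = 1 + (3 - r) / (1 + r) := by
    field_simp
    ring
  linarith

lemma cubeAvg_succ' {n : ℕ} (e : Bool) (F : (Fin (n + 1) → Bool) → ℝ) :
    cubeAvg F = (cubeAvg (fun σ => F (Fin.cons e σ)) +
      cubeAvg (fun σ => F (Fin.cons (!e) σ))) / 2 := by
  rw [cubeAvg_succ]
  cases e
  · simp [add_comm]
  · simp

lemma cubeProb_succ {n : ℕ} (e : Bool) (p : (Fin (n + 1) → Bool) → Prop) :
    cubeProb p = (cubeProb (fun σ => p (Fin.cons e σ)) +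
      cubeProb (fun σ => p (Fin.cons (!e) σ))) / 2 :=
  cubeAvg_succ' e _

/-- Weighted arithmetic-geometric mean, in the form of an averaged Hölder inequality. -/
lemma cubeAvg_exp_convex_le {n : ℕ} (f g : (Fin n → Bool) → ℝ) {p q l : ℝ} (hp : 0 < p)
    (hq : 0 < q) (hl0 : 0 ≤ l) (hl1 : l ≤ 1)
    (hf : cubeAvg (fun σ => Real.exp (f σ)) * p ≤ 1)
    (hg : cubeAvg (fun σ => Real.exp (g σ)) * q ≤ 1) :
    cubeAvg (fun σ => Real.exp (l * f σ + (1 - l) * g σ)) ≤ p ^ (-l) * q ^ (-(1 - l)) := by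
  have key : ∀ σ, Real.exp (l * f σ + (1 - l) * g σ) ≤
      p ^ (-l) * q ^ (-(1 - l)) *
        (l * p * Real.exp (f σ) + (1 - l) * q * Real.exp (g σ)) := by
    intro σ
    have h := Real.geom_mean_le_arith_mean2_weighted hl0 (sub_nonneg.2 hl1)
      (mul_nonneg hp.le (Real.exp_pos (f σ)).le) (mul_nonneg hq.le (Real.exp_pos (g σ)).le)
      (by ring)
    rw [Real.mul_rpow hp.le (Real.exp_pos _).le, Real.mul_rpow hq.le (Real.exp_pos _).le,
      ← Real.exp_mul, ← Real.exp_mul] at h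
    have h' := mul_le_mul_of_nonneg_left h
      (mul_nonneg (Real.rpow_nonneg hp.le (-l)) (Real.rpow_nonneg hq.le (-(1 - l))))
    calc Real.exp (l * f σ + (1 - l) * g σ)
        = (p ^ (-l) * p ^ l) * (q ^ (-(1 - l)) * q ^ (1 - l)) *
            (Real.exp (f σ * l) * Real.exp (g σ * (1 - l))) := by
          rw [← Real.rpow_add hp, ← Real.rpow_add hq, ← Real.exp_add]
          simp [mul_comm]
      _ = p ^ (-l) * q ^ (-(1 - l)) *
            (p ^ l * Real.exp (f σ * l) * (q ^ (1 - l) * Real.exp (g σ * (1 - l)))) := by ring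
      _ ≤ _ := by linarith
  refine (cubeAvg_mono key).trans ?_
  rw [cubeAvg_const_mul, cubeAvg_add, cubeAvg_const_mul, cubeAvg_const_mul]
  refine mul_le_of_le_one_right (by positivity) ?_
  nlinarith

/-- The squared Euclidean distance from a sign vector to a point. -/
noncomputable def cubeDistSq {n : ℕ} (σ : Fin n → Bool) (y : Fin n → ℝ) : ℝ :=
  ∑ i, (boolSign (σ i) - y i) ^ 2

lemma cubeDistSq_nonneg {n : ℕ} (σ : Fin n → Bool) (y : Fin n → ℝ) : 0 ≤ cubeDistSq σ y :=
  Finset.sum_nonneg fun _ _ => sq_nonneg _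

lemma cubeDistSq_cons {n : ℕ} (e : Bool) (σ : Fin n → Bool) (c : ℝ) (y : Fin n → ℝ) :
    cubeDistSq (Fin.cons e σ) (Fin.cons c y : Fin (n + 1) → ℝ) =
      (boolSign e - c) ^ 2 + cubeDistSq σ y := by
  simp [cubeDistSq, Fin.sum_univ_succ]

lemma cubeDistSq_convex_le {n : ℕ} (σ : Fin n → Bool) (y z : Fin n → ℝ) {l : ℝ} (hl0 : 0 ≤ l)
    (hl1 : l ≤ 1) :
    cubeDistSq σ (l • y + (1 - l) • z) ≤ l * cubeDistSq σ y + (1 - l) * cubeDistSq σ z := by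
  unfold cubeDistSq
  rw [Finset.mul_sum, Finset.mul_sum, ← Finset.sum_add_distrib]
  refine Finset.sum_le_sum fun i _ => ?_
  simp only [Pi.add_apply, Pi.smul_apply, smul_eq_mul]
  nlinarith [mul_nonneg (mul_nonneg hl0 (sub_nonneg.2 hl1)) (sq_nonneg (y i - z i))]

/-- **Talagrand's convex concentration inequality** on the discrete cube. Instead of the distance
to the convex set `V`, the statement provides a selection `y` of points of `V`. -/
theorem exists_selection_cubeAvg_exp_le {n : ℕ} (V : Set (Fin n → ℝ)) (hV : Convex ℝ V)
    (hpos : 0 < cubeProb fun σ : Fin n → Bool => (fun i => boolSign (σ i)) ∈ V) :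
    ∃ y : (Fin n → Bool) → Fin n → ℝ, (∀ σ, y σ ∈ V) ∧
      cubeAvg (fun σ => Real.exp (cubeDistSq σ (y σ) / 8)) *
        cubeProb (fun σ : Fin n → Bool => (fun i => boolSign (σ i)) ∈ V) ≤ 1 := by
  induction n with
  | zero =>
    obtain ⟨σ, hσ⟩ := exists_of_cubeProb_pos hpos
    refine ⟨fun _ i => boolSign (σ i), fun _ => hσ, ?_⟩
    have h : cubeProb (fun σ : Fin 0 → Bool => (fun i => boolSign (σ i)) ∈ V) ≤ 1 := by
      rw [cubeProb, cubeAvg_zero]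
      split_ifs <;> norm_num
    simpa [cubeAvg_zero, cubeDistSq] using h
  | succ n ih =>
    -- the faces of `V` and their proportions
    let W : Bool → Set (Fin n → ℝ) := fun e =>
      {y | (Fin.cons (boolSign e) y : Fin (n + 1) → ℝ) ∈ V}
    let p : Bool → ℝ := fun e => cubeProb fun σ : Fin n → Bool => (fun i => boolSign (σ i)) ∈ W e
    have hcons : ∀ (l m c d : ℝ) (y z : Fin n → ℝ),
        l • (Fin.cons c y : Fin (n + 1) → ℝ) + m • (Fin.cons d z : Fin (n + 1) → ℝ) =
          Fin.cons (l * c + m * d) (l • y + m • z) := by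
      intro l m c d y z
      funext i
      refine Fin.cases ?_ (fun j => ?_) i <;> simp
    have hW : ∀ e, Convex ℝ (W e) := by
      intro e y hy z hz l m hl hm hlm
      have := hV hy hz hl hm hlm
      rw [hcons, ← add_mul, hlm, one_mul] at this
      exact this
    have hsign : ∀ (e : Bool) (σ : Fin n → Bool),
        (fun i => boolSign ((Fin.cons e σ : Fin (n + 1) → Bool) i)) =
          (Fin.cons (boolSign e) fun i => boolSign (σ i) : Fin (n + 1) → ℝ) := by
      intro e σ
      funext i
      refine Fin.cases ?_ (fun j => ?_) i <;> simp
    have hp : ∀ e : Bool, cubeProb (fun σ : Fin (n + 1) → Bool => (fun i => boolSign (σ i)) ∈ V) =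
        (p e + p (!e)) / 2 := by
      intro e
      have hmem : ∀ (e : Bool) (σ : Fin n → Bool),
          ((fun i => boolSign ((Fin.cons e σ : Fin (n + 1) → Bool) i)) ∈ V) =
            ((fun i => boolSign (σ i)) ∈ W e) := by
        intro e σ
        rw [hsign]
        rfl
      rw [cubeProb_succ e]
      simp only [hmem, p]
    have hp0 : ∀ e, 0 ≤ p e := fun e => cubeProb_nonneg _
    -- `e` is the majority face
    obtain ⟨e, he⟩ : ∃ e : Bool, p (!e) ≤ p e := by
      rcases le_total (p true) (p false) with h | h
      · exact ⟨false, h⟩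
      · exact ⟨true, h⟩
    rw [hp e] at hpos ⊢
    have hpe : 0 < p e := by linarith [hp0 e]
    obtain ⟨y₁, hy₁, hb₁⟩ := ih (W e) (hW e) hpe
    change _ * p e ≤ 1 at hb₁
    have hB₁ : cubeAvg (fun σ => Real.exp (cubeDistSq σ (y₁ σ) / 8)) ≤ 1 / p e := by
      rwa [le_div_iff₀ hpe]
    have hne : ∀ e : Bool, (boolSign (!e) - boolSign e) ^ 2 = 4 := by
      intro e
      cases e <;> norm_num
    rcases (hp0 (!e)).eq_or_lt with h0 | h0
    · -- an empty minority face: project onto the majority face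
      refine ⟨fun σ => Fin.cons (boolSign e) (y₁ (Fin.tail σ)), fun σ => hy₁ _, ?_⟩
      rw [cubeAvg_succ' e]
      simp only [cubeDistSq_cons, Fin.tail_cons, sub_self, hne, ← h0, add_div, Real.exp_add,
        cubeAvg_const_mul]
      have hexp : Real.exp (4 / 8) ≤ 3 := by
        have : Real.exp (4 / 8) ≤ Real.exp 1 := Real.exp_le_exp.2 (by norm_num)
        linarith [Real.exp_one_lt_d9]
      have hnn : 0 ≤ cubeAvg (fun σ => Real.exp (cubeDistSq σ (y₁ σ) / 8)) * p e :=
        mul_nonneg (cubeAvg_nonneg fun σ => (Real.exp_pos _).le) hpe.le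
      norm_num
      nlinarith
    · obtain ⟨y₀, hy₀, hb₀⟩ := ih (W (!e)) (hW _) h0
      change _ * p (!e) ≤ 1 at hb₀
      set r : ℝ := p (!e) / p e with hr
      have hr0 : 0 < r := by positivity
      have hr1 : r ≤ 1 := (div_le_one hpe).2 he
      let z : Bool → (Fin n → Bool) → Fin (n + 1) → ℝ := fun b σ =>
        if b = e then Fin.cons (boolSign e) (y₁ σ)
        else (1 - r) • (Fin.cons (boolSign e) (y₁ σ) : Fin (n + 1) → ℝ) +
          r • (Fin.cons (boolSign (!e)) (y₀ σ) : Fin (n + 1) → ℝ)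
      refine ⟨fun σ => z (σ 0) (Fin.tail σ), fun σ => ?_, ?_⟩
      · by_cases hb : σ 0 = e
        · simp only [z, hb, if_true]
          exact hy₁ _
        · simp only [z, hb, if_false]
          exact hV (hy₁ _) (hy₀ _) (sub_nonneg.2 hr1) hr0.le (by ring)
      · rw [cubeAvg_succ' e]
        simp only [Fin.cons_zero, Fin.tail_cons]
        have hze : ∀ σ, cubeDistSq (Fin.cons e σ) (z e σ) = cubeDistSq σ (y₁ σ) := by
          intro σ
          simp [z, cubeDistSq_cons]
        have hzn : ∀ σ, Real.exp (cubeDistSq (Fin.cons (!e) σ) (z (!e) σ) / 8) ≤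
            Real.exp ((1 - r) ^ 2 / 2) * Real.exp ((1 - r) * (cubeDistSq σ (y₁ σ) / 8) +
              (1 - (1 - r)) * (cubeDistSq σ (y₀ σ) / 8)) := by
          intro σ
          have hz : z (!e) σ = Fin.cons ((1 - r) * boolSign e + r * boolSign (!e))
              ((1 - r) • y₁ σ + (1 - (1 - r)) • y₀ σ) := by
            have : (!e) ≠ e := by cases e <;> simp
            simp only [z, this, if_false, hcons, sub_sub_cancel]
          rw [hz, cubeDistSq_cons, ← Real.exp_add]
          apply Real.exp_le_exp.2
          have h1 := cubeDistSq_convex_le σ (y₁ σ) (y₀ σ) (sub_nonneg.2 hr1)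
            (by linarith : 1 - r ≤ 1)
          have h2 : (boolSign (!e) - ((1 - r) * boolSign e + r * boolSign (!e))) ^ 2 =
              (1 - r) ^ 2 * 4 := by
            rw [← hne e]
            ring
          rw [h2]
          linarith
        have hH := cubeAvg_exp_convex_le (fun σ => cubeDistSq σ (y₁ σ) / 8)
          (fun σ => cubeDistSq σ (y₀ σ) / 8) hpe h0 (sub_nonneg.2 hr1)
          (by linarith : 1 - r ≤ 1) hb₁ hb₀
        have hpow : p e ^ (-(1 - r)) * p (!e) ^ (-(1 - (1 - r))) = 1 / p e * r ^ (-r) := by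
          have : p (!e) = p e * r := by rw [hr]; field_simp
          rw [this, Real.mul_rpow hpe.le hr0.le, ← mul_assoc, ← Real.rpow_add hpe, one_div,
            ← Real.rpow_neg_one]
          congr 2 <;> ring
        have hA : cubeAvg (fun σ => Real.exp (cubeDistSq (Fin.cons (!e) σ) (z (!e) σ) / 8)) ≤
            Real.exp ((1 - r) ^ 2 / 2) * (1 / p e * r ^ (-r)) := by
          refine (cubeAvg_mono hzn).trans ?_
          rw [cubeAvg_const_mul, ← hpow]
          exact mul_le_mul_of_nonneg_left hH (Real.exp_pos _).le
        simp only [hze]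
        have hfin := one_add_exp_mul_rpow_le hr0 hr1
        have hpr : p (!e) = p e * r := by rw [hr]; field_simp
        have hr1' : 0 < 1 + r := by linarith
        calc _ ≤ (1 / p e + Real.exp ((1 - r) ^ 2 / 2) * (1 / p e * r ^ (-r))) / 2 *
              ((p e + p (!e)) / 2) := by gcongr
          _ = (1 + Real.exp ((1 - r) ^ 2 / 2) * r ^ (-r)) * (1 + r) / 4 := by
            rw [hpr]
            field_simp
            ring
          _ ≤ 4 / (1 + r) * (1 + r) / 4 := by gcongr
          _ = 1 := by field_simp

/-! ### Moments of scalar Rademacher sums -/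

/-- The scalar Rademacher sum `∑ ± aᵢ` as a function on the cube. -/
noncomputable def radSum {n : ℕ} (a : Fin n → ℝ) (σ : Fin n → Bool) : ℝ :=
  ∑ i, boolSign (σ i) * a i

lemma radSum_cons {n : ℕ} (a : Fin (n + 1) → ℝ) (e : Bool) (σ : Fin n → Bool) :
    radSum a (Fin.cons e σ) = boolSign e * a 0 + radSum (fun i => a i.succ) σ := by
  simp [radSum, Fin.sum_univ_succ]

lemma cubeAvg_radSum_sq {n : ℕ} (a : Fin n → ℝ) :
    cubeAvg (fun σ => radSum a σ ^ 2) = ∑ i, a i ^ 2 := by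
  induction n with
  | zero => simp [cubeAvg_zero, radSum]
  | succ n ih =>
    rw [cubeAvg_succ, ← cubeAvg_add, Fin.sum_univ_succ, ← ih]
    have : ∀ σ : Fin n → Bool, radSum a (Fin.cons true σ) ^ 2 + radSum a (Fin.cons false σ) ^ 2 =
        2 * a 0 ^ 2 + 2 * radSum (fun i => a i.succ) σ ^ 2 := by
      intro σ
      simp only [radSum_cons, boolSign_true, boolSign_false]
      ring
    simp only [this]
    rw [cubeAvg_add, cubeAvg_const, cubeAvg_const_mul]
    ring

lemma cubeAvg_radSum_pow_four_le {n : ℕ} (a : Fin n → ℝ) :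
    cubeAvg (fun σ => radSum a σ ^ 4) ≤ 3 * (∑ i, a i ^ 2) ^ 2 := by
  induction n with
  | zero => simp [cubeAvg_zero, radSum]
  | succ n ih =>
    rw [cubeAvg_succ, ← cubeAvg_add, Fin.sum_univ_succ]
    have : ∀ σ : Fin n → Bool, radSum a (Fin.cons true σ) ^ 4 + radSum a (Fin.cons false σ) ^ 4 =
        2 * a 0 ^ 4 + (12 * a 0 ^ 2 * radSum (fun i => a i.succ) σ ^ 2 +
          2 * radSum (fun i => a i.succ) σ ^ 4) := by
      intro σ
      simp only [radSum_cons, boolSign_true, boolSign_false]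
      ring
    simp only [this]
    rw [cubeAvg_add, cubeAvg_const, cubeAvg_add, cubeAvg_const_mul, cubeAvg_const_mul,
      cubeAvg_radSum_sq]
    nlinarith [ih fun i => a i.succ, sq_nonneg (a 0 ^ 2)]

/-- A Paley–Zygmund estimate: a Rademacher sum which is small with probability `4 / 5` has small
variance. -/
lemma sum_sq_le_of_cubeProb_le {n : ℕ} (a : Fin n → ℝ) {s : ℝ} (hs : 0 ≤ s)
    (h : cubeProb (fun σ => s < |radSum a σ|) ≤ 1 / 5) : ∑ i, a i ^ 2 ≤ 5 * s ^ 2 := by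
  classical
  set A := ∑ i, a i ^ 2 with hA
  set I : (Fin n → Bool) → ℝ := fun σ => if s < |radSum a σ| then 1 else 0 with hI
  set w := cubeAvg (fun σ => radSum a σ ^ 2 * I σ) with hw
  have h1 : A ≤ s ^ 2 + w := by
    rw [hA, ← cubeAvg_radSum_sq, hw, ← cubeAvg_const (n := n) (s ^ 2), ← cubeAvg_add]
    refine cubeAvg_mono fun σ => ?_
    by_cases hσ : s < |radSum a σ|
    · simp only [hI, hσ, if_true]
      nlinarith [sq_nonneg s]
    · simp only [hI, hσ, if_false]
      have := sq_le_sq' (by linarith [abs_nonneg (radSum a σ)]) (not_lt.1 hσ)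
      rw [sq_abs] at this
      linarith
  have hI2 : cubeAvg (fun σ => I σ ^ 2) ≤ 1 / 5 := by
    refine le_trans (le_of_eq ?_) h
    unfold cubeProb
    congr 1
    funext σ
    simp only [hI]
    split_ifs <;> norm_num
  have h2 : w ^ 2 ≤ 3 * A ^ 2 * (1 / 5) := by
    refine (cubeAvg_mul_sq_le _ _).trans ?_
    refine mul_le_mul ?_ hI2 (cubeAvg_nonneg fun σ => sq_nonneg _) (by positivity)
    refine le_trans (le_of_eq ?_) (cubeAvg_radSum_pow_four_le a)
    congr 1
    funext σ
    ring
  by_contra! hc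
  have h3 : 4 / 5 * A < w := by linarith
  have hA0 : 0 < A := lt_of_le_of_lt (by positivity) hc
  nlinarith

/-! ### Riesz products and the lower tail -/

/-- The Riesz product `∏ (1 ± bᵢ)`: the density that gives the `i`-th sign the mean `bᵢ` and keeps
the signs independent. -/
noncomputable def rieszProd {n : ℕ} (b : Fin n → ℝ) (σ : Fin n → Bool) : ℝ :=
  ∏ i, (1 + boolSign (σ i) * b i)

lemma rieszProd_cons {n : ℕ} (b : Fin (n + 1) → ℝ) (e : Bool) (σ : Fin n → Bool) :
    rieszProd b (Fin.cons e σ) = (1 + boolSign e * b 0) * rieszProd (fun i => b i.succ) σ := by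
  simp [rieszProd, Fin.prod_univ_succ]

lemma rieszProd_nonneg {n : ℕ} {b : Fin n → ℝ} (hb : ∀ i, |b i| ≤ 1) (σ : Fin n → Bool) :
    0 ≤ rieszProd b σ := by
  refine Finset.prod_nonneg fun i _ => ?_
  have := neg_le_of_abs_le (a := boolSign (σ i) * b i) (b := 1)
    (by rw [abs_mul, abs_boolSign, one_mul]; exact hb i)
  linarith

lemma cubeAvg_rieszProd {n : ℕ} (b : Fin n → ℝ) : cubeAvg (rieszProd b) = 1 := by
  induction n with
  | zero => simp [cubeAvg_zero, rieszProd]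
  | succ n ih =>
    rw [cubeAvg_succ]
    simp only [rieszProd_cons, boolSign_true, boolSign_false, cubeAvg_const_mul, ih]
    ring

lemma cubeAvg_rieszProd_sq_le {n : ℕ} (b : Fin n → ℝ) :
    cubeAvg (fun σ => rieszProd b σ ^ 2) ≤ Real.exp (∑ i, b i ^ 2) := by
  induction n with
  | zero => simp [cubeAvg_zero, rieszProd]
  | succ n ih =>
    rw [cubeAvg_succ]
    simp only [rieszProd_cons, mul_pow, boolSign_true, boolSign_false, cubeAvg_const_mul,
      Fin.sum_univ_succ, Real.exp_add]
    have h1 := ih fun i => b i.succ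
    have h2 := Real.add_one_le_exp (b 0 ^ 2)
    have h3 := cubeAvg_nonneg fun σ => sq_nonneg (rieszProd (fun i => b i.succ) σ)
    calc _ = (b 0 ^ 2 + 1) * cubeAvg (fun σ => rieszProd (fun i => b i.succ) σ ^ 2) := by ring
      _ ≤ _ := by gcongr

lemma cubeAvg_rieszProd_mul_radSum {n : ℕ} (a b : Fin n → ℝ) :
    cubeAvg (fun σ => rieszProd b σ * radSum a σ) = ∑ i, a i * b i := by
  induction n with
  | zero => simp [cubeAvg_zero, radSum]
  | succ n ih =>
    rw [cubeAvg_succ, ← cubeAvg_add, Fin.sum_univ_succ, ← ih]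
    have : ∀ σ : Fin n → Bool, rieszProd b (Fin.cons true σ) * radSum a (Fin.cons true σ) +
        rieszProd b (Fin.cons false σ) * radSum a (Fin.cons false σ) =
        2 * (a 0 * b 0) * rieszProd (fun i => b i.succ) σ +
          2 * (rieszProd (fun i => b i.succ) σ * radSum (fun i => a i.succ) σ) := by
      intro σ
      simp only [radSum_cons, rieszProd_cons, boolSign_true, boolSign_false]
      ring
    simp only [this]
    rw [cubeAvg_add, cubeAvg_const_mul, cubeAvg_const_mul, cubeAvg_rieszProd]
    ring

lemma cubeAvg_rieszProd_mul_radSum_sq_le {n : ℕ} (a b : Fin n → ℝ) :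
    cubeAvg (fun σ => rieszProd b σ * radSum a σ ^ 2) ≤
      ∑ i, a i ^ 2 + (∑ i, a i * b i) ^ 2 := by
  induction n with
  | zero => simp [cubeAvg_zero, radSum]
  | succ n ih =>
    rw [cubeAvg_succ, ← cubeAvg_add, Fin.sum_univ_succ, Fin.sum_univ_succ]
    have : ∀ σ : Fin n → Bool, rieszProd b (Fin.cons true σ) * radSum a (Fin.cons true σ) ^ 2 +
        rieszProd b (Fin.cons false σ) * radSum a (Fin.cons false σ) ^ 2 =
        2 * a 0 ^ 2 * rieszProd (fun i => b i.succ) σ +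
          (4 * (a 0 * b 0) * (rieszProd (fun i => b i.succ) σ * radSum (fun i => a i.succ) σ) +
            2 * (rieszProd (fun i => b i.succ) σ * radSum (fun i => a i.succ) σ ^ 2)) := by
      intro σ
      simp only [radSum_cons, rieszProd_cons, boolSign_true, boolSign_false]
      ring
    simp only [this]
    rw [cubeAvg_add, cubeAvg_add, cubeAvg_const_mul, cubeAvg_const_mul, cubeAvg_const_mul,
      cubeAvg_rieszProd, cubeAvg_rieszProd_mul_radSum]
    nlinarith [ih (fun i => a i.succ) (fun i => b i.succ), sq_nonneg (a 0 * b 0)]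

/-- The lower tail estimate for Rademacher sums: after the change of measure by the Riesz product,
`∑ ± aᵢ` concentrates around `L = ∑ aᵢ bᵢ`, and the change of measure costs `exp (∑ bᵢ²)`. -/
lemma exp_neg_le_cubeProb_radSum {n : ℕ} (a b : Fin n → ℝ) (hb : ∀ i, |b i| ≤ 1) {L : ℝ}
    (hL : L = ∑ i, a i * b i) (hL0 : 0 < L) (hA : 16 * ∑ i, a i ^ 2 ≤ L ^ 2) :
    9 / 16 * Real.exp (-∑ i, b i ^ 2) ≤ cubeProb fun σ => L / 2 < radSum a σ := by
  classical
  set I : (Fin n → Bool) → ℝ := fun σ => if L / 2 < radSum a σ then 1 else 0 with hI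
  have hIsq : cubeAvg (fun σ => I σ ^ 2) = cubeProb fun σ => L / 2 < radSum a σ := by
    unfold cubeProb
    congr 1
    funext σ
    simp only [hI]
    split_ifs <;> norm_num
  -- Chebyshev's inequality under the density `rieszProd b`
  have hcheb : 3 / 4 ≤ cubeAvg (fun σ => rieszProd b σ * I σ) := by
    have hpt : ∀ σ, rieszProd b σ ≤ rieszProd b σ * I σ +
        (4 / L ^ 2 * (rieszProd b σ * radSum a σ ^ 2) +
          (-8 / L * (rieszProd b σ * radSum a σ) + 4 * rieszProd b σ)) := by
      intro σ
      have hR := rieszProd_nonneg hb σ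
      have e : 4 / L ^ 2 * (rieszProd b σ * radSum a σ ^ 2) +
          (-8 / L * (rieszProd b σ * radSum a σ) + 4 * rieszProd b σ) =
          rieszProd b σ * (4 * ((radSum a σ - L) / L) ^ 2) := by
        field_simp
        ring
      rw [e]
      by_cases hσ : L / 2 < radSum a σ
      · simp only [hI, hσ, if_true]
        nlinarith [mul_nonneg hR (sq_nonneg ((radSum a σ - L) / L))]
      · simp only [hI, hσ, if_false]
        have h1 : 1 / 2 ≤ (L - radSum a σ) / L := by
          rw [le_div_iff₀ hL0]
          linarith [not_lt.1 hσ]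
        have h2 : (radSum a σ - L) / L = -((L - radSum a σ) / L) := by ring
        rw [h2, neg_sq]
        have h3 : 1 ≤ 4 * ((L - radSum a σ) / L) ^ 2 := by nlinarith
        nlinarith
    have h := cubeAvg_mono hpt
    rw [cubeAvg_add, cubeAvg_add, cubeAvg_add, cubeAvg_const_mul, cubeAvg_const_mul,
      cubeAvg_const_mul, cubeAvg_rieszProd, cubeAvg_rieszProd_mul_radSum, ← hL] at h
    have hV := cubeAvg_rieszProd_mul_radSum_sq_le a b
    rw [← hL] at hV
    have hq : 4 / L ^ 2 * cubeAvg (fun σ => rieszProd b σ * radSum a σ ^ 2) ≤ 17 / 4 := by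
      rw [div_mul_eq_mul_div, div_le_iff₀ (by positivity)]
      linarith
    have hl : -8 / L * L = -8 := by field_simp
    linarith
  have hCS := cubeAvg_mul_sq_le (rieszProd b) I
  rw [hIsq] at hCS
  have hP := cubeProb_nonneg fun σ => L / 2 < radSum a σ
  have h1 : 9 / 16 ≤ Real.exp (∑ i, b i ^ 2) * cubeProb fun σ => L / 2 < radSum a σ := by
    calc (9 : ℝ) / 16 ≤ cubeAvg (fun σ => rieszProd b σ * I σ) ^ 2 := by nlinarith
      _ ≤ _ := hCS
      _ ≤ _ := by
        gcongr
        exact cubeAvg_rieszProd_sq_le b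
  rw [Real.exp_neg, ← div_eq_mul_inv, div_le_iff₀ (Real.exp_pos _)]
  linarith

/-! ### Vector-valued Rademacher sums on the cube -/

section Vector

variable {𝕜 E : Type*} [RCLike 𝕜] [NormedAddCommGroup E] [NormedSpace 𝕜 E]

lemma norm_sum_sub_le {n : ℕ} (x : Fin n → E) (u y : Fin n → ℝ) :
    ‖∑ i, ((u i : ℝ) : 𝕜) • x i‖ ≤ ‖∑ i, ((y i : ℝ) : 𝕜) • x i‖ +
      ‖∑ i, ((u i - y i : ℝ) : 𝕜) • x i‖ := by
  have : ∑ i, ((u i : ℝ) : 𝕜) • x i = ∑ i, ((y i : ℝ) : 𝕜) • x i +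
      ∑ i, ((u i - y i : ℝ) : 𝕜) • x i := by
    rw [← Finset.sum_add_distrib]
    refine Finset.sum_congr rfl fun i _ => ?_
    rw [← add_smul, ← RCLike.ofReal_add]
    congr 2
    ring
  rw [this]
  exact norm_add_le _ _

lemma convex_norm_sum_le {n : ℕ} (x : Fin n → E) (s : ℝ) :
    Convex ℝ {y : Fin n → ℝ | ‖∑ i, ((y i : ℝ) : 𝕜) • x i‖ ≤ s} := by
  intro y hy z hz l m hl hm hlm
  simp only [Set.mem_ofPred_eq] at hy hz ⊢
  have : ∑ i, (((l • y + m • z) i : ℝ) : 𝕜) • x i =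
      (l : 𝕜) • ∑ i, ((y i : ℝ) : 𝕜) • x i + (m : 𝕜) • ∑ i, ((z i : ℝ) : 𝕜) • x i := by
    rw [Finset.smul_sum, Finset.smul_sum, ← Finset.sum_add_distrib]
    refine Finset.sum_congr rfl fun i _ => ?_
    rw [smul_smul, smul_smul, ← add_smul]
    simp
  rw [this]
  refine (norm_add_le _ _).trans ?_
  rw [norm_smul, norm_smul, RCLike.norm_ofReal, RCLike.norm_ofReal, abs_of_nonneg hl,
    abs_of_nonneg hm]
  calc l * ‖∑ i, ((y i : ℝ) : 𝕜) • x i‖ + m * ‖∑ i, ((z i : ℝ) : 𝕜) • x i‖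
      ≤ l * s + m * s := by gcongr
    _ = s := by rw [← add_mul, hlm, one_mul]

/-- By Hahn–Banach, the norm of a real combination of the `xᵢ` is controlled by the functionals in
the unit ball. -/
lemma norm_sum_le_of_forall_dual {n : ℕ} (x : Fin n → E) (z : Fin n → ℝ) {K : ℝ}
    (h : ∀ f : StrongDual 𝕜 E, ‖f‖ ≤ 1 → ‖∑ i, ((z i : ℝ) : 𝕜) * f (x i)‖ ≤ K) :
    ‖∑ i, ((z i : ℝ) : 𝕜) • x i‖ ≤ K := by
  obtain ⟨f, hf, hfx⟩ := exists_dual_vector'' 𝕜 (∑ i, ((z i : ℝ) : 𝕜) • x i)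
  have h1 := h f hf
  have h2 : f (∑ i, ((z i : ℝ) : 𝕜) • x i) = ∑ i, ((z i : ℝ) : 𝕜) * f (x i) := by
    simp [map_sum]
  rw [← h2, hfx] at h1
  simpa using h1

/-- The norm of the vector-valued Rademacher sum `∑ ± xᵢ` as a function on the cube. -/
noncomputable def radNorm (𝕜 : Type*) {E : Type*} [RCLike 𝕜] [NormedAddCommGroup E]
    [NormedSpace 𝕜 E] {n : ℕ} (x : Fin n → E) (σ : Fin n → Bool) : ℝ :=
  ‖∑ i, ((boolSign (σ i) : ℝ) : 𝕜) • x i‖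

lemma radNorm_nonneg {n : ℕ} (x : Fin n → E) (σ : Fin n → Bool) : 0 ≤ radNorm 𝕜 x σ :=
  norm_nonneg _

lemma norm_sum_boolSign_mul_le_radNorm {n : ℕ} (x : Fin n → E) {f : StrongDual 𝕜 E}
    (hf : ‖f‖ ≤ 1) (σ : Fin n → Bool) :
    ‖∑ i, ((boolSign (σ i) : ℝ) : 𝕜) * f (x i)‖ ≤ radNorm 𝕜 x σ := by
  have h2 : f (∑ i, ((boolSign (σ i) : ℝ) : 𝕜) • x i) =
      ∑ i, ((boolSign (σ i) : ℝ) : 𝕜) * f (x i) := by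
    simp [map_sum]
  rw [← h2]
  exact f.le_of_opNorm_le hf _ |>.trans (by rw [one_mul, radNorm])

lemma abs_radSum_re_le_radNorm {n : ℕ} (x : Fin n → E) {f : StrongDual 𝕜 E} (hf : ‖f‖ ≤ 1)
    (σ : Fin n → Bool) : |radSum (fun i => RCLike.re (f (x i))) σ| ≤ radNorm 𝕜 x σ := by
  refine le_trans ?_ (norm_sum_boolSign_mul_le_radNorm x hf σ)
  refine le_trans (le_of_eq ?_) (RCLike.abs_re_le_norm _)
  simp [radSum]

lemma abs_radSum_im_le_radNorm {n : ℕ} (x : Fin n → E) {f : StrongDual 𝕜 E} (hf : ‖f‖ ≤ 1)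
    (σ : Fin n → Bool) : |radSum (fun i => RCLike.im (f (x i))) σ| ≤ radNorm 𝕜 x σ := by
  refine le_trans ?_ (norm_sum_boolSign_mul_le_radNorm x hf σ)
  refine le_trans (le_of_eq ?_) (RCLike.abs_im_le_norm _)
  simp [radSum]

/-- A real sequence whose Rademacher sum is dominated by `‖∑ ± xᵢ‖` has small `ℓ₂` norm as soon as
`‖∑ ± xᵢ‖` is small with probability `4 / 5`. -/
lemma sum_sq_le_of_abs_radSum_le {n : ℕ} (x : Fin n → E) {s : ℝ} (hs : 0 ≤ s)
    (h : cubeProb (fun σ => s < radNorm 𝕜 x σ) ≤ 1 / 5) (a : Fin n → ℝ)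
    (ha : ∀ σ, |radSum a σ| ≤ radNorm 𝕜 x σ) : ∑ i, a i ^ 2 ≤ 5 * s ^ 2 :=
  sum_sq_le_of_cubeProb_le a hs ((cubeProb_mono fun σ hσ => hσ.trans_le (ha σ)).trans h)

lemma sum_norm_sq_le_of_cubeProb_le {n : ℕ} (x : Fin n → E) {s : ℝ} (hs : 0 ≤ s)
    (h : cubeProb (fun σ => s < radNorm 𝕜 x σ) ≤ 1 / 5) {f : StrongDual 𝕜 E} (hf : ‖f‖ ≤ 1) :
    ∑ i, ‖f (x i)‖ ^ 2 ≤ 10 * s ^ 2 := by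
  have h1 := sum_sq_le_of_abs_radSum_le x hs h _ (abs_radSum_re_le_radNorm x hf)
  have h2 := sum_sq_le_of_abs_radSum_le x hs h _ (abs_radSum_im_le_radNorm x hf)
  have : ∀ i, ‖f (x i)‖ ^ 2 = RCLike.re (f (x i)) ^ 2 + RCLike.im (f (x i)) ^ 2 := by
    intro i
    rw [RCLike.norm_sq_eq_def]
    ring
  simp only [this, Finset.sum_add_distrib]
  linarith

/-- If `‖∑ ± xᵢ‖` is at most `s` with probability `4 / 5`, then its mean is at most `6 s`: by convex
concentration, `‖∑ ± xᵢ‖ - s` is of the order of the weak `ℓ₂` norm, which is itself at most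
`√10 s`. -/
lemma cubeAvg_radNorm_le {n : ℕ} (x : Fin n → E) {s : ℝ} (hs : 0 ≤ s)
    (h : cubeProb (fun σ => s < radNorm 𝕜 x σ) ≤ 1 / 5) : cubeAvg (radNorm 𝕜 x) ≤ 6 * s := by
  set V : Set (Fin n → ℝ) := {y | ‖∑ i, ((y i : ℝ) : 𝕜) • x i‖ ≤ s} with hV
  have hp : 4 / 5 ≤ cubeProb fun σ : Fin n → Bool => (fun i => boolSign (σ i)) ∈ V := by
    have h1 := cubeProb_add_not fun σ : Fin n → Bool => s < radNorm 𝕜 x σ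
    have h2 : cubeProb (fun σ : Fin n → Bool => ¬ s < radNorm 𝕜 x σ) ≤
        cubeProb fun σ : Fin n → Bool => (fun i => boolSign (σ i)) ∈ V :=
      cubeProb_mono fun σ hσ => not_lt.1 hσ
    linarith
  obtain ⟨y, hyV, hy⟩ := exists_selection_cubeAvg_exp_le V (convex_norm_sum_le x s) (by linarith)
  have hexp : cubeAvg (fun σ => Real.exp (cubeDistSq σ (y σ) / 8)) ≤ 5 / 4 := by
    have := cubeAvg_nonneg fun σ => (Real.exp_pos (cubeDistSq σ (y σ) / 8)).le
    nlinarith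
  have hpt : ∀ σ, radNorm 𝕜 x σ ≤ 8 * s * Real.exp (cubeDistSq σ (y σ) / 8) + -(9 / 2) * s := by
    intro σ
    set d := cubeDistSq σ (y σ) with hd
    have hd0 : 0 ≤ d := cubeDistSq_nonneg _ _
    have h1 : ‖∑ i, ((boolSign (σ i) - y σ i : ℝ) : 𝕜) • x i‖ ≤ (5 / 2 + d) * s := by
      refine norm_sum_le_of_forall_dual x _ fun f hf => ?_
      have hf2 := sum_norm_sq_le_of_cubeProb_le x hs h hf
      have h2 : ‖∑ i, ((boolSign (σ i) - y σ i : ℝ) : 𝕜) * f (x i)‖ ≤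
          ∑ i, |boolSign (σ i) - y σ i| * ‖f (x i)‖ := by
        refine (norm_sum_le _ _).trans (le_of_eq ?_)
        simp only [norm_mul, RCLike.norm_ofReal]
      refine h2.trans (abs_le_of_sq_le_sq' ?_ (by positivity)).2
      refine (Finset.sum_mul_sq_le_sq_mul_sq _ _ _).trans ?_
      simp only [sq_abs]
      calc _ ≤ d * (10 * s ^ 2) := mul_le_mul_of_nonneg_left hf2 hd0
        _ ≤ _ := by nlinarith [mul_nonneg (sq_nonneg s) (sq_nonneg (5 / 2 - d))]
    have h2 := norm_sum_sub_le (𝕜 := 𝕜) x (fun i => boolSign (σ i)) (y σ)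
    have h3 : ‖∑ i, ((y σ i : ℝ) : 𝕜) • x i‖ ≤ s := hyV σ
    have h4 := Real.add_one_le_exp (d / 8)
    have h5 : s * (d / 8 + 1) ≤ s * Real.exp (d / 8) := mul_le_mul_of_nonneg_left h4 hs
    unfold radNorm
    linarith
  have h1 := cubeAvg_mono hpt
  rw [cubeAvg_add, cubeAvg_const_mul, cubeAvg_const] at h1
  nlinarith

/-- The upper tail estimate: a displacement inside the cube by Euclidean distance `v` changes
`‖∑ ± xᵢ‖` by at most `K`, and by convex concentration a larger displacement from the set where
`‖∑ ± xᵢ‖` is at most twice its mean has probability at most `2 exp (-v² / 8)`. -/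
lemma cubeProb_radNorm_gt_le {n : ℕ} (x : Fin n → E) {M K v : ℝ} (hM : 0 < M)
    (hav : cubeAvg (radNorm 𝕜 x) ≤ M)
    (hK : ∀ f : StrongDual 𝕜 E, ‖f‖ ≤ 1 → ∀ z : Fin n → ℝ, (∀ i, |z i| ≤ 2) →
      ∑ i, z i ^ 2 ≤ v ^ 2 → ‖∑ i, ((z i : ℝ) : 𝕜) * f (x i)‖ ≤ K) :
    cubeProb (fun σ => 2 * M + K < radNorm 𝕜 x σ) ≤ 2 * Real.exp (-(v ^ 2 / 8)) := by
  set V : Set (Fin n → ℝ) := {y | ‖∑ i, ((y i : ℝ) : 𝕜) • x i‖ ≤ 2 * M} ∩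
    Set.Icc (fun _ => -1) (fun _ => 1) with hV
  have hconv : Convex ℝ V := (convex_norm_sum_le x (2 * M)).inter (convex_Icc _ _)
  have hp : 1 / 2 ≤ cubeProb fun σ : Fin n → Bool => (fun i => boolSign (σ i)) ∈ V := by
    have h1 := cubeProb_add_not fun σ : Fin n → Bool => 2 * M < radNorm 𝕜 x σ
    have h2 : cubeProb (fun σ : Fin n → Bool => ¬ 2 * M < radNorm 𝕜 x σ) ≤
        cubeProb fun σ : Fin n → Bool => (fun i => boolSign (σ i)) ∈ V :=
      cubeProb_mono fun σ hσ => ⟨not_lt.1 hσ,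
        fun i => (abs_le.1 (abs_boolSign (σ i)).le).1,
        fun i => (abs_le.1 (abs_boolSign (σ i)).le).2⟩
    have h3 := mul_cubeProb_le (radNorm_nonneg (𝕜 := 𝕜) x) (2 * M)
      (fun σ => 2 * M < radNorm 𝕜 x σ) fun σ hσ => hσ.le
    nlinarith
  obtain ⟨y, hyV, hy⟩ := exists_selection_cubeAvg_exp_le V hconv (by linarith)
  have hexp : cubeAvg (fun σ => Real.exp (cubeDistSq σ (y σ) / 8)) ≤ 2 := by
    have := cubeAvg_nonneg fun σ => (Real.exp_pos (cubeDistSq σ (y σ) / 8)).le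
    nlinarith
  have hfar : ∀ σ, 2 * M + K < radNorm 𝕜 x σ →
      Real.exp (v ^ 2 / 8) ≤ Real.exp (cubeDistSq σ (y σ) / 8) := by
    intro σ hσ
    apply Real.exp_le_exp.2
    by_contra! hlt
    have h1 : ‖∑ i, ((boolSign (σ i) - y σ i : ℝ) : 𝕜) • x i‖ ≤ K := by
      refine norm_sum_le_of_forall_dual x _ fun f hf => hK f hf _ (fun i => ?_) ?_
      · have h2 := (hyV σ).2.1 i
        have h3 := (hyV σ).2.2 i
        have h4 := abs_le.1 (abs_boolSign (σ i)).le
        simp only at h2 h3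
        exact abs_le.2 ⟨by linarith [h4.1], by linarith [h4.2]⟩
      · have : cubeDistSq σ (y σ) ≤ v ^ 2 := by linarith
        exact this
    have h2 := norm_sum_sub_le (𝕜 := 𝕜) x (fun i => boolSign (σ i)) (y σ)
    have h3 : ‖∑ i, ((y σ i : ℝ) : 𝕜) • x i‖ ≤ 2 * M := (hyV σ).1
    unfold radNorm at hσ
    linarith
  have h1 := mul_cubeProb_le (fun σ => (Real.exp_pos (cubeDistSq σ (y σ) / 8)).le) _ _ hfar
  rw [Real.exp_neg, ← div_eq_mul_inv, le_div_iff₀ (Real.exp_pos _)]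
  linarith

end Vector

/-! ### The K-functional of the couple of `ℓ₁` and `ℓ₂` -/

/-- Truncation of a nonnegative finite family at the level where the dual extremal sequence
`b = min 1 (l m)` has `ℓ₂` norm `v`: the sum of the large terms plus `v` times the `ℓ₂` norm of the
small terms is at most `2 ∑ m b`. -/
lemma exists_truncation {ι : Type*} [DecidableEq ι] (I : Finset ι) (m : ι → ℝ)
    (hm : ∀ i, 0 ≤ m i) {v : ℝ} (hv : 0 < v) : ∃ (b : ι → ℝ) (T : Finset ι), T ⊆ I ∧ (∀ i, 0 ≤ b i ∧ b i ≤ 1) ∧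
      ∑ i ∈ I, b i ^ 2 ≤ v ^ 2 ∧
      ∑ i ∈ T, m i + v * √(∑ i ∈ I \ T, m i ^ 2) ≤ 2 * ∑ i ∈ I, m i * b i := by
  classical
  by_cases hJ : (((I.filter fun i => m i ≠ 0).card : ℕ) : ℝ) ≤ v ^ 2
  · -- few nonzero terms: the family itself is a good `ℓ₁` part
    refine ⟨fun i => if m i ≠ 0 then 1 else 0, I.filter fun i => m i ≠ 0,
      Finset.filter_subset _ _, fun i => by dsimp only; split_ifs <;> norm_num, ?_, ?_⟩
    · simp only [ite_pow, one_pow, zero_pow two_ne_zero, Finset.sum_boole]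
      exact hJ
    · have h1 : ∑ i ∈ I \ I.filter (fun i => m i ≠ 0), m i ^ 2 = 0 := by
        refine Finset.sum_eq_zero fun i hi => ?_
        simp only [Finset.mem_sdiff, Finset.mem_filter, not_and, not_not] at hi
        simp [hi.2 hi.1]
      have h2 : ∑ i ∈ I.filter (fun i => m i ≠ 0), m i =
          ∑ i ∈ I, m i * (if m i ≠ 0 then 1 else 0) := by
        rw [Finset.sum_filter]
        simp only [mul_ite, mul_one, mul_zero]
      have h3 : 0 ≤ ∑ i ∈ I.filter (fun i => m i ≠ 0), m i := Finset.sum_nonneg fun i _ => hm i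
      rw [h1, ← h2, Real.sqrt_zero]
      linarith
  · set g : ℝ → ℝ := fun l => ∑ i ∈ I, (min 1 (l * m i)) ^ 2 with hg
    have hgc : Continuous g := by fun_prop
    set Λ : ℝ := ∑ i ∈ I, (m i)⁻¹ with hΛ
    have hΛ0 : 0 ≤ Λ := Finset.sum_nonneg fun i _ => inv_nonneg.2 (hm i)
    have hgΛ : v ^ 2 ≤ g Λ := by
      refine (not_le.1 hJ).le.trans ?_
      rw [Finset.card_filter]
      push_cast
      refine Finset.sum_le_sum fun i hi => ?_
      by_cases h0 : m i = 0
      · simp [h0]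
      · have : 1 ≤ Λ * m i := by
          have h1 : (m i)⁻¹ ≤ Λ :=
            Finset.single_le_sum (f := fun i => (m i)⁻¹) (fun i _ => inv_nonneg.2 (hm i)) hi
          calc (1 : ℝ) = (m i)⁻¹ * m i := (inv_mul_cancel₀ h0).symm
            _ ≤ _ := mul_le_mul_of_nonneg_right h1 (hm i)
        simp [h0, min_eq_left this]
    have hg0 : g 0 = 0 := by simp [hg]
    obtain ⟨l, ⟨hl0, -⟩, hl⟩ := intermediate_value_Icc hΛ0 hgc.continuousOn
      (show v ^ 2 ∈ Set.Icc (g 0) (g Λ) from ⟨by rw [hg0]; positivity, hgΛ⟩)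
    have hlpos : 0 < l := by
      refine hl0.lt_of_ne fun h => ?_
      rw [← h, hg0] at hl
      have : 0 < v ^ 2 := by positivity
      linarith
    set T := I.filter fun i => 1 < l * m i with hT
    have hnot : I \ T = I.filter fun i => ¬ 1 < l * m i := by
      ext i
      simp only [hT, Finset.mem_sdiff, Finset.mem_filter]
      tauto
    refine ⟨fun i => min 1 (l * m i), T, Finset.filter_subset _ _,
      fun i => ⟨le_min zero_le_one (mul_nonneg hl0 (hm i)), min_le_left _ _⟩, hl.le, ?_⟩
    rw [hnot]
    set p := ∑ i ∈ T, m i with hp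
    set q := ∑ i ∈ I with ¬ 1 < l * m i, m i ^ 2 with hq
    have hq0 : 0 ≤ q := Finset.sum_nonneg fun i _ => sq_nonneg _
    have hsum : ∑ i ∈ I, m i * min 1 (l * m i) = p + l * q := by
      rw [← Finset.sum_filter_add_sum_filter_not I (fun i => 1 < l * m i), hp, hq, Finset.mul_sum]
      congr 1
      · refine Finset.sum_congr rfl fun i hi => ?_
        rw [min_eq_left (Finset.mem_filter.1 hi).2.le, mul_one]
      · refine Finset.sum_congr rfl fun i hi => ?_
        rw [min_eq_right (not_lt.1 (Finset.mem_filter.1 hi).2)]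
        ring
    have hv2 : v ^ 2 ≤ l * p + l ^ 2 * q := by
      rw [← hl, hg]
      dsimp only
      rw [← Finset.sum_filter_add_sum_filter_not I (fun i => 1 < l * m i), hp, hq, Finset.mul_sum,
        Finset.mul_sum]
      gcongr with i hi i hi
      · have := (Finset.mem_filter.1 hi).2
        rw [min_eq_left this.le, one_pow]
        exact this.le
      · rw [min_eq_right (not_lt.1 (Finset.mem_filter.1 hi).2), mul_pow]
    rw [hsum]
    have hs : √q ^ 2 = q := Real.sq_sqrt hq0
    -- multiplied by `l`, the claim is `l p + v (l √q) ≤ 2 (l p + (l √q)²)`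
    refine le_of_mul_le_mul_left ?_ hlpos
    nlinarith [sq_nonneg (v - l * √q)]

section KFunctional

variable {𝕜 : Type*} [RCLike 𝕜]

lemma K12_le_of_decomposition {a : ℕ → 𝕜} {u : ℝ} (hu : 0 ≤ u) (b : lp (fun _ : ℕ => 𝕜) 1)
    (c : lp (fun _ : ℕ => 𝕜) 2) (h : ∀ n, a n = b n + c n) : K12 a u ≤ ‖b‖ + u * ‖c‖ := by
  refine csInf_le ⟨0, ?_⟩ ⟨b, c, h, rfl⟩
  rintro r ⟨b', c', -, rfl⟩
  positivity

lemma le_K12 {a : ℕ → 𝕜} (ha : Memℓp a 2) {u r : ℝ}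
    (h : ∀ (b : lp (fun _ : ℕ => 𝕜) 1) (c : lp (fun _ : ℕ => 𝕜) 2), (∀ n, a n = b n + c n) →
      r ≤ ‖b‖ + u * ‖c‖) : r ≤ K12 a u := by
  refine le_csInf ⟨_, 0, ⟨a, ha⟩, fun n => ?_, rfl⟩ ?_
  · simp
  · rintro _ ⟨b, c, hbc, rfl⟩
    exact h b c hbc

lemma K12_nonneg (a : ℕ → 𝕜) {u : ℝ} (hu : 0 ≤ u) : 0 ≤ K12 a u := by
  refine Real.sInf_nonneg ?_
  rintro _ ⟨b, c, -, rfl⟩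
  positivity

/-- Splitting off finitely many terms bounds the `K`-functional. -/
lemma K12_le_sum_add {a : ℕ → 𝕜} {u Q : ℝ} (hu : 0 ≤ u) (hQ : 0 ≤ Q) (T : Finset ℕ)
    (h : ∀ s : Finset ℕ, Disjoint s T → ∑ n ∈ s, ‖a n‖ ^ 2 ≤ Q ^ 2) :
    K12 a u ≤ ∑ n ∈ T, ‖a n‖ + u * Q := by
  classical
  set b : ℕ → 𝕜 := fun n => if n ∈ T then a n else 0 with hb
  set c : ℕ → 𝕜 := fun n => if n ∈ T then 0 else a n with hc
  have hbs : ∀ s : Finset ℕ, ∑ n ∈ s, ‖b n‖ ^ (1 : ℝ≥0∞).toReal ≤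
      (∑ n ∈ T, ‖a n‖) ^ (1 : ℝ≥0∞).toReal := by
    intro s
    simp only [ENNReal.toReal_one, Real.rpow_one]
    calc ∑ n ∈ s, ‖b n‖ = ∑ n ∈ s with n ∈ T, ‖a n‖ := by
          rw [Finset.sum_filter]
          refine Finset.sum_congr rfl fun n _ => ?_
          simp only [hb]
          split_ifs <;> simp
      _ ≤ _ := Finset.sum_le_sum_of_subset_of_nonneg
          (fun n hn => (Finset.mem_filter.1 hn).2) fun _ _ _ => norm_nonneg _
  have hcs : ∀ s : Finset ℕ, ∑ n ∈ s, ‖c n‖ ^ (2 : ℝ≥0∞).toReal ≤ Q ^ (2 : ℝ≥0∞).toReal := by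
    intro s
    simp only [ENNReal.toReal_ofNat, Real.rpow_ofNat]
    calc ∑ n ∈ s, ‖c n‖ ^ 2 = ∑ n ∈ s with n ∉ T, ‖a n‖ ^ 2 := by
          rw [Finset.sum_filter]
          refine Finset.sum_congr rfl fun n _ => ?_
          simp only [hc]
          split_ifs <;> simp
      _ ≤ _ := h _ (Finset.disjoint_left.2 fun n hn => (Finset.mem_filter.1 hn).2)
  let B : lp (fun _ : ℕ => 𝕜) 1 := ⟨b, memℓp_gen' hbs⟩
  let D : lp (fun _ : ℕ => 𝕜) 2 := ⟨c, memℓp_gen' hcs⟩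
  have hB : ‖B‖ ≤ ∑ n ∈ T, ‖a n‖ := lp.norm_le_of_forall_sum_le (by simp)
    (Finset.sum_nonneg fun _ _ => norm_nonneg _) hbs
  have hD : ‖D‖ ≤ Q := lp.norm_le_of_forall_sum_le (by simp) hQ hcs
  refine (K12_le_of_decomposition hu B D fun n => ?_).trans (by gcongr)
  simp only [B, D, hb, hc]
  split_ifs <;> simp

/-- Duality between the `K`-functional and the sequences that are bounded by `2` in `ℓ_∞` and by
`4 u` in `ℓ₂`. -/
lemma norm_sum_mul_le_K12 {a : ℕ → 𝕜} (ha : Memℓp a 2) {u : ℝ} (hu : 0 ≤ u) {n : ℕ}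
    (z : Fin n → ℝ) (hz : ∀ i, |z i| ≤ 2) (hz2 : ∑ i, z i ^ 2 ≤ (4 * u) ^ 2) :
    ‖∑ i : Fin n, ((z i : ℝ) : 𝕜) * a i‖ ≤ 4 * K12 a u := by
  suffices h : ‖∑ i : Fin n, ((z i : ℝ) : 𝕜) * a i‖ / 4 ≤ K12 a u by linarith
  refine le_K12 ha fun b c hbc => ?_
  have hb : ∑ i : Fin n, ‖b i‖ ≤ ‖b‖ := by
    have := lp.sum_rpow_le_norm_rpow (by simp) b (Finset.range n)
    simp only [ENNReal.toReal_one, Real.rpow_one] at this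
    rwa [Finset.sum_range] at this
  have hc : ∑ i : Fin n, ‖c i‖ ^ 2 ≤ ‖c‖ ^ 2 := by
    have := lp.sum_rpow_le_norm_rpow (by simp) c (Finset.range n)
    simp only [ENNReal.toReal_ofNat, Real.rpow_ofNat] at this
    rwa [Finset.sum_range] at this
  have h1 : ‖∑ i : Fin n, ((z i : ℝ) : 𝕜) * a i‖ ≤
      ∑ i : Fin n, 2 * ‖b i‖ + ∑ i : Fin n, |z i| * ‖c i‖ := by
    rw [← Finset.sum_add_distrib]
    refine norm_sum_le_of_le _ fun i _ => ?_
    rw [hbc, mul_add]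
    refine (norm_add_le _ _).trans ?_
    rw [norm_mul, norm_mul, RCLike.norm_ofReal]
    gcongr
    exact hz i
  have h2 : ∑ i : Fin n, |z i| * ‖c i‖ ≤ 4 * u * ‖c‖ := by
    refine (abs_le_of_sq_le_sq' ?_ (by positivity)).2
    refine (Finset.sum_mul_sq_le_sq_mul_sq _ _ _).trans ?_
    simp only [sq_abs]
    rw [mul_pow]
    gcongr
  rw [← Finset.mul_sum] at h1
  have := norm_nonneg b
  linarith

end KFunctional

/-! ### The K-functional and the quantiles of Rademacher sums -/

section KUpper

variable {𝕜 E : Type*} [RCLike 𝕜] [NormedAddCommGroup E] [NormedSpace 𝕜 E]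

/-- If `‖∑ ± xᵢ‖ ≤ s` with probability at least `1 - 2 t`, the coefficients `a` of a dominated real
Rademacher sum pair boundedly with the sequences of `ℓ_∞` norm at most `1` and `ℓ₂` norm at most
`√(log (1 / t)) / 2`: otherwise the lower tail estimate would give a larger probability. -/
lemma sum_abs_mul_le_of_cubeProb_le {n : ℕ} (x : Fin n → E) {s t : ℝ} (hs : 0 < s) (ht : 0 < t)
    (ht' : t ≤ 1 / 10) (h : cubeProb (fun σ => s < radNorm 𝕜 x σ) ≤ 2 * t) (a b : Fin n → ℝ)
    (ha : ∀ σ, |radSum a σ| ≤ radNorm 𝕜 x σ) (hb : ∀ i, 0 ≤ b i ∧ b i ≤ 1)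
    (hb2 : ∑ i, b i ^ 2 ≤ (√(Real.log (1 / t)) / 2) ^ 2) : ∑ i, |a i| * b i ≤ 9 * s := by
  by_contra! hL
  have hA := sum_sq_le_of_abs_radSum_le x hs.le (h.trans (by linarith)) a ha
  set b' : Fin n → ℝ := fun i => if 0 ≤ a i then b i else -b i with hb'
  have hsum : ∑ i, |a i| * b i = ∑ i, a i * b' i := by
    refine Finset.sum_congr rfl fun i _ => ?_
    simp only [hb']
    split_ifs with h0
    · rw [abs_of_nonneg h0]
    · rw [abs_of_neg (not_le.1 h0)]
      ring
  have hbabs : ∀ i, |b' i| ≤ 1 := by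
    intro i
    simp only [hb']
    split_ifs
    · rw [abs_of_nonneg (hb i).1]
      exact (hb i).2
    · rw [abs_neg, abs_of_nonneg (hb i).1]
      exact (hb i).2
  have hbsq : ∑ i, b' i ^ 2 = ∑ i, b i ^ 2 := by
    refine Finset.sum_congr rfl fun i _ => ?_
    simp only [hb']
    split_ifs <;> ring
  have hlow := exp_neg_le_cubeProb_radSum a b' hbabs hsum (by linarith) (by nlinarith)
  rw [hbsq] at hlow
  have hup : cubeProb (fun σ => (∑ i, |a i| * b i) / 2 < radSum a σ) ≤ 2 * t := by
    refine (cubeProb_mono fun σ hσ => ?_).trans h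
    calc s < (∑ i, |a i| * b i) / 2 := by linarith
      _ < radSum a σ := hσ
      _ ≤ _ := (le_abs_self _).trans (ha σ)
  have hlog : 0 ≤ Real.log (1 / t) :=
    Real.log_nonneg ((one_le_div ht).2 (by linarith))
  -- `q = t ^ (1 / 4)`
  set q := Real.exp (Real.log t / 4) with hq
  have hq4 : q ^ 4 = t := by
    rw [hq, ← Real.exp_nat_mul]
    push_cast
    rw [mul_div_cancel₀ _ (by norm_num : (4 : ℝ) ≠ 0), Real.exp_log ht]
  have hqle : q ≤ Real.exp (-∑ i, b i ^ 2) := by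
    apply Real.exp_le_exp.2
    rw [div_pow, Real.sq_sqrt hlog, one_div, Real.log_inv] at hb2
    linarith
  have hq0 : 0 < q := Real.exp_pos _
  have h1 : 9 / 16 * q ≤ 2 * q ^ 4 := by
    rw [hq4]
    linarith
  have h2 : 9 / 32 ≤ q ^ 3 := by
    by_contra! hc
    nlinarith
  have h3 : (9 / 32 : ℝ) ^ 4 ≤ (1 / 10) ^ 3 := by
    calc (9 / 32 : ℝ) ^ 4 ≤ (q ^ 3) ^ 4 := by gcongr
      _ = t ^ 3 := by rw [← hq4]; ring
      _ ≤ _ := by gcongr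
  norm_num at h3

/-- The weak `K`-functional is bounded by the quantiles of the partial sums. -/
lemma K12_le_of_eventually_cubeProb_le (x : ℕ → E) {s t : ℝ} (hs : 0 < s) (ht : 0 < t)
    (ht' : t ≤ 1 / 10)
    (h : ∀ᶠ N : ℕ in atTop, cubeProb (fun σ => s < radNorm 𝕜 (fun i : Fin N => x i) σ) ≤ 2 * t)
    {f : StrongDual 𝕜 E} (hf : ‖f‖ ≤ 1) (hmem : Memℓp (fun n => f (x n)) 2) :
    K12 (fun n => f (x n)) √(Real.log (1 / t)) ≤ 73 * s := by
  set u := √(Real.log (1 / t)) with hu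
  have hu0 : 0 < u := Real.sqrt_pos.2 (Real.log_pos ((one_lt_div ht).2 (by linarith)))
  have hsum : Summable fun n => ‖f (x n)‖ ^ 2 := by
    have := hmem.summable (by simp)
    simpa using this
  obtain ⟨S₀, hS₀⟩ := summable_iff_vanishing_norm.1 hsum ((s / u) ^ 2) (by positivity)
  obtain ⟨N, hN, hS₀N⟩ := (h.and (eventually_ge_atTop (S₀.sup id + 1))).exists
  obtain ⟨b, T, hTI, hb, hb2, hbT⟩ := exists_truncation (Finset.range N) (fun n => ‖f (x n)‖)
    (fun n => norm_nonneg _) (half_pos hu0)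
  set q := √(∑ n ∈ Finset.range N \ T, ‖f (x n)‖ ^ 2) with hq
  have hq0 : 0 ≤ q := Real.sqrt_nonneg _
  have hqsq : q ^ 2 = ∑ n ∈ Finset.range N \ T, ‖f (x n)‖ ^ 2 :=
    Real.sq_sqrt (Finset.sum_nonneg fun _ _ => sq_nonneg _)
  have hK : K12 (fun n => f (x n)) u ≤ ∑ n ∈ T, ‖f (x n)‖ + u * (q + s / u) := by
    refine K12_le_sum_add hu0.le (by positivity) T fun S hS => ?_
    have htail : ∑ n ∈ S \ Finset.range N, ‖f (x n)‖ ^ 2 ≤ (s / u) ^ 2 := by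
      refine (le_abs_self _).trans (hS₀ _ (Finset.disjoint_left.2 fun n hn hn0 => ?_)).le
      have h1 : n ≤ S₀.sup id := Finset.le_sup (f := id) hn0
      have h2 := (Finset.mem_sdiff.1 hn).2
      rw [Finset.mem_range] at h2
      omega
    have hhead : ∑ n ∈ S ∩ Finset.range N, ‖f (x n)‖ ^ 2 ≤ q ^ 2 := by
      rw [hqsq]
      refine Finset.sum_le_sum_of_subset_of_nonneg (fun n hn => ?_) fun _ _ _ => sq_nonneg _
      rw [Finset.mem_inter] at hn
      exact Finset.mem_sdiff.2 ⟨hn.2, Finset.disjoint_left.1 hS hn.1⟩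
    have hsplit := Finset.sum_inter_add_sum_sdiff S (Finset.range N) fun n => ‖f (x n)‖ ^ 2
    have : 0 ≤ q * (s / u) := by positivity
    nlinarith
  have hb2' : ∑ i : Fin N, b i ^ 2 ≤ (u / 2) ^ 2 := by
    rwa [Finset.sum_range] at hb2
  have hre := sum_abs_mul_le_of_cubeProb_le _ hs ht ht' hN _ (fun i => b i)
    (abs_radSum_re_le_radNorm _ hf) (fun i => hb i) hb2'
  have him := sum_abs_mul_le_of_cubeProb_le _ hs ht ht' hN _ (fun i => b i)
    (abs_radSum_im_le_radNorm _ hf) (fun i => hb i) hb2'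
  have hpair : ∑ n ∈ Finset.range N, ‖f (x n)‖ * b n ≤ 18 * s := by
    rw [Finset.sum_range]
    calc ∑ i : Fin N, ‖f (x i)‖ * b i
        ≤ ∑ i : Fin N, (|RCLike.re (f (x i))| * b i + |RCLike.im (f (x i))| * b i) := by
          refine Finset.sum_le_sum fun i _ => ?_
          rw [← add_mul]
          refine mul_le_mul_of_nonneg_right ?_ (hb i).1
          refine abs_le_of_sq_le_sq' ?_ (by positivity) |>.2
          rw [RCLike.norm_sq_eq_def]
          nlinarith [abs_mul_abs_self (RCLike.re (f (x i))), abs_mul_abs_self (RCLike.im (f (x i))),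
            mul_nonneg (abs_nonneg (RCLike.re (f (x i)))) (abs_nonneg (RCLike.im (f (x i))))]
      _ ≤ 18 * s := by
          rw [Finset.sum_add_distrib]
          linarith
  have hus : u * (s / u) = s := by field_simp
  have hT0 : 0 ≤ ∑ n ∈ T, ‖f (x n)‖ := Finset.sum_nonneg fun _ _ => norm_nonneg _
  have : u * (q + s / u) = 2 * (u / 2 * q) + s := by rw [mul_add, hus]; ring
  linarith

end KUpper

/-! ### Rademacher sequences on a probability space -/

section Law

variable {Ω : Type*} [MeasurableSpace Ω] {P : Measure Ω} {ε : ℕ → Ω → ℝ}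
  {𝕜 E : Type*} [RCLike 𝕜] [NormedAddCommGroup E] [NormedSpace 𝕜 E] {x : ℕ → E} {X : Ω → E}

open Classical in
/-- The first `n` signs of a Rademacher sequence, as a random point of the cube. -/
noncomputable def signPattern (ε : ℕ → Ω → ℝ) (n : ℕ) (ω : Ω) : Fin n → Bool :=
  fun i => decide (ε i ω = 1)

lemma measurable_signPattern (hε : IsRademacherSeq P ε) (n : ℕ) :
    Measurable (signPattern ε n) := by
  classical
  refine measurable_pi_lambda _ fun i => ?_
  refine measurable_to_bool ?_
  have : (fun ω => signPattern ε n ω i) ⁻¹' {true} = ε i ⁻¹' {1} := by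
    ext ω
    simp [signPattern]
  rw [this]
  exact hε.measurable i (measurableSet_singleton 1)

lemma aestronglyMeasurable_partialSum (𝕜 : Type*) [RCLike 𝕜] [NormedSpace 𝕜 E]
    (hε : IsRademacherSeq P ε) (x : ℕ → E) (n : ℕ) :
    AEStronglyMeasurable (fun ω => ∑ i ∈ Finset.range n, (ε i ω : 𝕜) • x i) P := by
  refine Finset.aestronglyMeasurable_fun_sum _ fun i _ => ?_
  exact ((RCLike.measurable_ofReal.comp (hε.measurable i)).stronglyMeasurable.smul_const
    (x i)).aestronglyMeasurable

lemma aestronglyMeasurable_of_isASSum (hε : IsRademacherSeq P ε)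
    (hX : IsASSum (𝕜 := 𝕜) P ε x X) : AEStronglyMeasurable X P :=
  aestronglyMeasurable_of_tendsto_ae _ (aestronglyMeasurable_partialSum 𝕜 hε x) hX

variable [IsProbabilityMeasure P]

lemma measureReal_signPattern_eq (hε : IsRademacherSeq P ε) {n : ℕ} (τ : Fin n → Bool) :
    P.real (signPattern ε n ⁻¹' {τ}) = 1 / 2 ^ n := by
  classical
  set A : Fin n → Set ℝ := fun i => if τ i then {1} else {1}ᶜ with hA
  have hset : signPattern ε n ⁻¹' {τ} = ⋂ i ∈ (Finset.univ : Finset (Fin n)), ε i ⁻¹' A i := by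
    ext ω
    simp only [Set.mem_preimage, Set.mem_singleton_iff, funext_iff, Finset.mem_univ,
      Set.iInter_true, Set.mem_iInter, hA, signPattern]
    refine forall_congr' fun i => ?_
    cases τ i <;> simp
  have hAm : ∀ i, MeasurableSet (A i) := by
    intro i
    simp only [hA]
    split_ifs
    · exact measurableSet_singleton 1
    · exact (measurableSet_singleton 1).compl
  have hind := hε.indep.precomp (g := fun i : Fin n => (i : ℕ)) Fin.val_injective
  have hone : ∀ i, P (ε i ⁻¹' {1}) = 2⁻¹ := by
    intro i
    have := hε.prob_one i
    rw [one_div] at this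
    exact this
  have hhalf : ∀ i : Fin n, P (ε i ⁻¹' A i) = 2⁻¹ := by
    intro i
    simp only [hA]
    split_ifs
    · exact hone i
    · rw [Set.preimage_compl, prob_compl_eq_one_sub (hε.measurable i (measurableSet_singleton 1)),
        hone, ENNReal.one_sub_inv_two]
  have h := hind.measure_inter_preimage_eq_mul Finset.univ (sets := A) fun i _ => hAm i
  rw [← hset, Finset.prod_congr rfl fun i _ => hhalf i] at h
  rw [measureReal_def, h]
  simp

lemma integral_signPattern (hε : IsRademacherSeq P ε) {n : ℕ} (F : (Fin n → Bool) → ℝ) :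
    ∫ ω, F (signPattern ε n ω) ∂P = cubeAvg F := by
  have hm := measurable_signPattern hε n
  rw [← integral_map (f := F) hm.aemeasurable (measurable_of_finite F).aestronglyMeasurable]
  have : IsProbabilityMeasure (P.map (signPattern ε n)) :=
    Measure.isProbabilityMeasure_map hm.aemeasurable
  rw [integral_fintype (Integrable.of_finite), cubeAvg, Finset.sum_div]
  refine Finset.sum_congr rfl fun τ _ => ?_
  rw [map_measureReal_apply hm (measurableSet_singleton τ), measureReal_signPattern_eq hε,
    smul_eq_mul]
  ring

lemma measureReal_signPattern (hε : IsRademacherSeq P ε) {n : ℕ} (p : (Fin n → Bool) → Prop) :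
    P.real {ω | p (signPattern ε n ω)} = cubeProb p := by
  classical
  have hm : MeasurableSet {ω | p (signPattern ε n ω)} :=
    measurable_signPattern hε n (Set.toFinite {τ | p τ}).measurableSet
  rw [cubeProb, ← integral_signPattern hε, ← integral_indicator_one hm]
  refine integral_congr_ae (Eventually.of_forall fun ω => ?_)
  by_cases h : p (signPattern ε n ω) <;> simp [Set.indicator, h]

lemma ae_eq_boolSign (hε : IsRademacherSeq P ε) :
    ∀ᵐ ω ∂P, ∀ (n : ℕ) (i : Fin n), ε i ω = boolSign (signPattern ε n ω i) := by
  classical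
  have h : ∀ i, ∀ᵐ ω ∂P, ε i ω = 1 ∨ ε i ω = -1 := by
    intro i
    have h1 : MeasurableSet {ω | ε i ω = 1} := hε.measurable i (measurableSet_singleton 1)
    have h2 : MeasurableSet {ω | ε i ω = -1} := hε.measurable i (measurableSet_singleton (-1))
    have hd : Disjoint {ω | ε i ω = 1} {ω | ε i ω = -1} := by
      refine Set.disjoint_left.2 fun ω ha hb => ?_
      simp only [Set.mem_ofPred_eq] at ha hb
      linarith
    have h3 : P ({ω | ε i ω = 1} ∪ {ω | ε i ω = -1}) = 1 := by
      rw [measure_union hd h2, hε.prob_one, hε.prob_neg_one, ENNReal.add_halves]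
    exact (prob_compl_eq_zero_iff (h1.union h2)).2 h3
  filter_upwards [ae_all_iff.2 h] with ω hω n i
  rcases hω i with h1 | h1
  · simp [signPattern, h1]
  · simp only [signPattern, h1]
    norm_num

lemma ae_norm_partialSum_eq (hε : IsRademacherSeq P ε) (x : ℕ → E) :
    ∀ᵐ ω ∂P, ∀ n : ℕ, ‖∑ i ∈ Finset.range n, (ε i ω : 𝕜) • x i‖ =
      radNorm 𝕜 (fun i : Fin n => x i) (signPattern ε n ω) := by
  filter_upwards [ae_eq_boolSign hε] with ω hω n
  rw [Finset.sum_range, radNorm]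
  congr 1
  exact Finset.sum_congr rfl fun i _ => by rw [hω n i]

lemma measureReal_norm_partialSum (𝕜 : Type*) [RCLike 𝕜] [NormedSpace 𝕜 E]
    (hε : IsRademacherSeq P ε) (x : ℕ → E) (n : ℕ) (s : ℝ) :
    P.real {ω | s < ‖∑ i ∈ Finset.range n, (ε i ω : 𝕜) • x i‖} =
      cubeProb fun σ => s < radNorm 𝕜 (fun i : Fin n => x i) σ := by
  rw [← measureReal_signPattern hε]
  refine measureReal_congr ?_
  filter_upwards [ae_norm_partialSum_eq (𝕜 := 𝕜) hε x] with ω hω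
  exact congrArg (fun r : ℝ => s < r) (hω n)

lemma tendsto_measureReal_norm_sub (hε : IsRademacherSeq P ε) (hX : IsASSum (𝕜 := 𝕜) P ε x X)
    {s : ℝ} (hs : 0 < s) :
    Tendsto (fun n : ℕ => P.real {ω | s ≤ ‖∑ i ∈ Finset.range n, (ε i ω : 𝕜) • x i - X ω‖})
      atTop (𝓝 0) :=
  tendstoInMeasure_iff_measureReal_norm.1
    (tendstoInMeasure_of_tendsto_ae (aestronglyMeasurable_partialSum 𝕜 hε x) hX) s hs

lemma eventually_cubeProb_le (hε : IsRademacherSeq P ε) (hX : IsASSum (𝕜 := 𝕜) P ε x X)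
    {s t : ℝ} (hs : 0 < s) (ht : 0 < t) (h : P.real {ω | s < ‖X ω‖} ≤ t) :
    ∀ᶠ N : ℕ in atTop,
      cubeProb (fun σ => 2 * s < radNorm 𝕜 (fun i : Fin N => x i) σ) ≤ 2 * t := by
  filter_upwards [(tendsto_measureReal_norm_sub hε hX hs).eventually_lt_const ht] with N hN
  rw [← measureReal_norm_partialSum 𝕜 hε]
  have hsub : {ω | 2 * s < ‖∑ i ∈ Finset.range N, (ε i ω : 𝕜) • x i‖} ⊆
      {ω | s < ‖X ω‖} ∪ {ω | s ≤ ‖∑ i ∈ Finset.range N, (ε i ω : 𝕜) • x i - X ω‖} := by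
    intro ω hω
    by_contra hc
    simp only [Set.mem_union, Set.mem_ofPred_eq, not_or, not_lt, not_le] at hω hc
    have := norm_le_norm_add_norm_sub' (∑ i ∈ Finset.range N, (ε i ω : 𝕜) • x i) (X ω)
    linarith
  have := (measureReal_mono (μ := P) hsub).trans (measureReal_union_le _ _)
  linarith

lemma measureReal_norm_gt_le (hε : IsRademacherSeq P ε) (hX : IsASSum (𝕜 := 𝕜) P ε x X)
    {s t : ℝ} (hs : 0 < s)
    (h : ∀ᶠ N : ℕ in atTop,
      cubeProb (fun σ => s < radNorm 𝕜 (fun i : Fin N => x i) σ) ≤ t) :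
    P.real {ω | 2 * s < ‖X ω‖} ≤ t := by
  have hlim := (tendsto_measureReal_norm_sub hε hX hs).const_add t
  rw [add_zero] at hlim
  refine ge_of_tendsto hlim ?_
  filter_upwards [h] with N hN
  rw [← measureReal_norm_partialSum 𝕜 hε] at hN
  have hsub : {ω | 2 * s < ‖X ω‖} ⊆
      {ω | s < ‖∑ i ∈ Finset.range N, (ε i ω : 𝕜) • x i‖} ∪
        {ω | s ≤ ‖∑ i ∈ Finset.range N, (ε i ω : 𝕜) • x i - X ω‖} := by
    intro ω hω
    by_contra hc
    simp only [Set.mem_union, Set.mem_ofPred_eq, not_or, not_lt, not_le] at hω hc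
    have := norm_le_norm_add_norm_sub (∑ i ∈ Finset.range N, (ε i ω : 𝕜) • x i) (X ω)
    linarith
  have := (measureReal_mono (μ := P) hsub).trans (measureReal_union_le _ _)
  linarith

/-- Fatou's lemma for the means of the partial sums. -/
lemma lintegral_enorm_le (hε : IsRademacherSeq P ε) (hX : IsASSum (𝕜 := 𝕜) P ε x X) {c : ℝ}
    (h : ∀ᶠ N : ℕ in atTop, cubeAvg (radNorm 𝕜 (fun i : Fin N => x i)) ≤ c) :
    ∫⁻ ω, ‖X ω‖ₑ ∂P ≤ ENNReal.ofReal c := by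
  have hN : ∀ N : ℕ, ∫⁻ ω, ‖∑ i ∈ Finset.range N, (ε i ω : 𝕜) • x i‖ₑ ∂P =
      ENNReal.ofReal (cubeAvg (radNorm 𝕜 (fun i : Fin N => x i))) := by
    intro N
    rw [← integral_signPattern hε, ofReal_integral_eq_lintegral_ofReal]
    · refine lintegral_congr_ae ?_
      filter_upwards [ae_norm_partialSum_eq (𝕜 := 𝕜) hε x] with ω hω
      rw [← ofReal_norm, hω N]
    · have hm := measurable_signPattern hε N
      have : IsProbabilityMeasure (P.map (signPattern ε N)) :=
        Measure.isProbabilityMeasure_map hm.aemeasurable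
      exact (Integrable.of_finite (μ := P.map (signPattern ε N))
        (f := radNorm 𝕜 (fun i : Fin N => x i))).comp_measurable hm
    · exact Eventually.of_forall fun ω => radNorm_nonneg _ _
  calc ∫⁻ ω, ‖X ω‖ₑ ∂P
      = ∫⁻ ω, liminf (fun N : ℕ => ‖∑ i ∈ Finset.range N, (ε i ω : 𝕜) • x i‖ₑ) atTop ∂P := by
        refine lintegral_congr_ae ?_
        filter_upwards [hX] with ω hω using hω.enorm.liminf_eq.symm
    _ ≤ liminf (fun N : ℕ => ∫⁻ ω, ‖∑ i ∈ Finset.range N, (ε i ω : 𝕜) • x i‖ₑ ∂P) atTop :=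
        lintegral_liminf_le' fun N => (aestronglyMeasurable_partialSum 𝕜 hε x N).enorm
    _ ≤ ENNReal.ofReal c := by
        refine liminf_le_of_frequently_le' (Eventually.frequently ?_)
        filter_upwards [h] with N hc
        rw [hN]
        exact ENNReal.ofReal_le_ofReal hc

/-- Tails of an almost surely finite random variable tend to zero. -/
lemma exists_measureReal_norm_gt_le (hX : AEStronglyMeasurable X P) {t : ℝ} (ht : 0 < t) :
    ∃ s : ℝ, 0 < s ∧ P.real {ω | s < ‖X ω‖} ≤ t := by
  have hconv : TendstoInMeasure P (fun (n : ℕ) ω => ‖X ω‖ / ((n : ℝ) + 1)) atTop fun _ => 0 := by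
    refine tendstoInMeasure_of_tendsto_ae (fun n => ?_) (Eventually.of_forall fun ω => ?_)
    · exact (hX.norm.aemeasurable.div_const _).aestronglyMeasurable
    · have h := (tendsto_one_div_add_atTop_nhds_zero_nat (𝕜 := ℝ)).const_mul ‖X ω‖
      rw [mul_zero] at h
      exact h.congr fun n => mul_one_div _ _
  have h := tendstoInMeasure_iff_measureReal_norm.1 hconv 1 one_pos
  obtain ⟨n, hn⟩ := (h.eventually_lt_const ht).exists
  refine ⟨n + 1, by positivity, (measureReal_mono fun ω hω => ?_).trans hn.le⟩
  simp only [Set.mem_ofPred_eq, sub_zero, norm_div, norm_norm] at hω ⊢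
  rw [Real.norm_of_nonneg (by positivity), le_div_iff₀ (by positivity), one_mul]
  exact hω.le

lemma integrable_norm_of_isASSum (hε : IsRademacherSeq P ε) (hX : IsASSum (𝕜 := 𝕜) P ε x X)
    {s : ℝ} (hs : 0 < s) (h : P.real {ω | s < ‖X ω‖} ≤ 1 / 10) :
    Integrable (fun ω => ‖X ω‖) P ∧ ∫ ω, ‖X ω‖ ∂P ≤ 12 * s := by
  have hmeas := aestronglyMeasurable_of_isASSum hε hX
  have hle := lintegral_enorm_le hε hX (c := 12 * s) <| by
    filter_upwards [eventually_cubeProb_le hε hX hs (by norm_num) h] with N hN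
    have := cubeAvg_radNorm_le _ (by positivity) (hN.trans (by norm_num))
    linarith
  refine ⟨Integrable.norm ⟨hmeas, hle.trans_lt ENNReal.ofReal_lt_top⟩, ?_⟩
  rw [integral_norm_eq_lintegral_enorm hmeas]
  exact ENNReal.toReal_le_of_le_ofReal (by positivity) hle

lemma weaklyMemlp_of_isASSum (hε : IsRademacherSeq P ε) (hX : IsASSum (𝕜 := 𝕜) P ε x X) :
    WeaklyMemlp 𝕜 2 x := by
  obtain ⟨s, hs, h⟩ := exists_measureReal_norm_gt_le (aestronglyMeasurable_of_isASSum hε hX)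
    (by norm_num : (0 : ℝ) < 1 / 10)
  have hev := eventually_cubeProb_le hε hX hs (by norm_num) h
  have hball : ∀ f : StrongDual 𝕜 E, ‖f‖ ≤ 1 → Memℓp (fun n => f (x n)) 2 := by
    intro f hf
    refine memℓp_gen' (C := 10 * (2 * s) ^ 2) fun S => ?_
    simp only [ENNReal.toReal_ofNat, Real.rpow_ofNat]
    obtain ⟨N, hN, hSN⟩ := (hev.and (eventually_ge_atTop (S.sup id + 1))).exists
    have h1 := sum_norm_sq_le_of_cubeProb_le _ (by positivity) (hN.trans (by norm_num)) hf
    refine le_trans ?_ h1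
    rw [← Finset.sum_range fun n => ‖f (x n)‖ ^ 2]
    refine Finset.sum_le_sum_of_subset_of_nonneg (fun n hn => ?_) fun _ _ _ => sq_nonneg _
    have : n ≤ S.sup id := Finset.le_sup (f := id) hn
    rw [Finset.mem_range]
    omega
  intro f
  have hc : (0 : ℝ) < ‖f‖ + 1 := by positivity
  set c : 𝕜 := ((‖f‖ + 1 : ℝ) : 𝕜) with hcdef
  have hc0 : c ≠ 0 := RCLike.ofReal_ne_zero.2 hc.ne'
  have hg := (hball (c⁻¹ • f) (by
    rw [norm_smul, norm_inv, hcdef, RCLike.norm_ofReal, abs_of_pos hc, inv_mul_le_iff₀ hc]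
    linarith)).const_smul c
  have heq : (c • fun n => (c⁻¹ • f) (x n)) = fun n => f (x n) := by
    funext n
    simp [hc0]
  rwa [heq] at hg

end Law

/-! ### Comparison of the quantiles with the mean and the weak K-functional -/

theorem corollary1 :
    ∃ C : ℝ, 0 < C ∧
      ∀ (𝕜 : Type*) [RCLike 𝕜]
        (E : Type*) [NormedAddCommGroup E] [NormedSpace 𝕜 E] [CompleteSpace E]
        (Ω : Type*) [MeasurableSpace Ω] (P : Measure Ω) [IsProbabilityMeasure P]
        (ε : ℕ → Ω → ℝ) (x : ℕ → E) (X : Ω → E),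
        IsRademacherSeq P ε → IsASSum (𝕜 := 𝕜) P ε x X →
          Integrable (fun ω => ‖X ω‖) P ∧
          WeaklyMemlp 𝕜 2 x ∧
          ∀ t : ℝ, 0 < t → t ≤ 1 / 10 →
            BddAbove (weakK12Set 𝕜 x √(Real.log (1 / t))) ∧
            1 / C * decreasingRearrangement P (fun ω => ‖X ω‖) t
              ≤ (∫ ω, ‖X ω‖ ∂P) + weakK12 𝕜 x √(Real.log (1 / t)) ∧
            (∫ ω, ‖X ω‖ ∂P) + weakK12 𝕜 x √(Real.log (1 / t))
              ≤ C * decreasingRearrangement P (fun ω => ‖X ω‖) t := by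
  refine ⟨480, by norm_num, ?_⟩
  intro 𝕜 _ E _ _ _ Ω _ P _ ε x X hε hX
  have hmeas := aestronglyMeasurable_of_isASSum hε hX
  have hweak := weaklyMemlp_of_isASSum hε hX
  have hint : Integrable (fun ω => ‖X ω‖) P := by
    obtain ⟨s, hs, h⟩ := exists_measureReal_norm_gt_le hmeas (by norm_num : (0 : ℝ) < 1 / 10)
    exact (integrable_norm_of_isASSum hε hX hs h).1
  refine ⟨hint, hweak, fun t ht ht' => ?_⟩
  set u := √(Real.log (1 / t)) with hu
  have hu0 : 0 ≤ u := Real.sqrt_nonneg _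
  set M := ∫ ω, ‖X ω‖ ∂P with hM
  have hM0 : 0 ≤ M := integral_nonneg fun ω => norm_nonneg _
  have hKs : ∀ s : ℝ, 0 < s → P.real {ω | s < ‖X ω‖} ≤ t → ∀ r ∈ weakK12Set 𝕜 x u,
      r ≤ 146 * s := by
    rintro s hs h r ⟨f, hf, rfl⟩
    have := K12_le_of_eventually_cubeProb_le x (by positivity : (0 : ℝ) < 2 * s) ht ht'
      (eventually_cubeProb_le hε hX hs ht h) hf (hweak f)
    linarith
  obtain ⟨s₀, hs₀, hPs₀⟩ := exists_measureReal_norm_gt_le hmeas ht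
  have hbdd : BddAbove (weakK12Set 𝕜 x u) := ⟨146 * s₀, hKs s₀ hs₀ hPs₀⟩
  have hK0 : 0 ≤ weakK12 𝕜 x u := by
    refine Real.sSup_nonneg ?_
    rintro _ ⟨f, -, rfl⟩
    exact K12_nonneg _ hu0
  have hKle : ∀ f : StrongDual 𝕜 E, ‖f‖ ≤ 1 → K12 (fun n => f (x n)) u ≤ weakK12 𝕜 x u :=
    fun f hf => le_csSup hbdd ⟨f, hf, rfl⟩
  have hrearr : decreasingRearrangement P (fun ω => ‖X ω‖) t =
      sInf {s : ℝ | 0 < s ∧ P.real {ω | s < ‖X ω‖} ≤ t} := by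
    simp only [decreasingRearrangement, abs_norm]
  rw [hrearr]
  refine ⟨hbdd, ?_, ?_⟩
  · have hmain : sInf {s : ℝ | 0 < s ∧ P.real {ω | s < ‖X ω‖} ≤ t} ≤
        480 * M + 8 * weakK12 𝕜 x u := by
      -- the mean is replaced by `M' > M`, which is positive even if `X = 0`
      refine le_of_forall_pos_le_add fun δ hδ => ?_
      set M' := M + δ / 480 with hM'
      have hM'0 : 0 < M' := by positivity
      have hmarkov : P.real {ω | 10 * M' < ‖X ω‖} ≤ 1 / 10 := by
        have h1 := mul_meas_ge_le_integral_of_nonneg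
          (Eventually.of_forall fun ω => norm_nonneg (X ω)) hint (10 * M')
        have h2 : P.real {ω | 10 * M' < ‖X ω‖} ≤ P.real {ω | 10 * M' ≤ ‖X ω‖} :=
          measureReal_mono fun ω (hω : 10 * M' < ‖X ω‖) => hω.le
        have h3 : M ≤ M' := by rw [hM']; linarith [div_pos hδ (by norm_num : (0 : ℝ) < 480)]
        by_contra! hc
        have h4 : 10 * M' * (1 / 10) < 10 * M' * P.real {ω | 10 * M' ≤ ‖X ω‖} := by
          gcongr
          linarith
        linarith
      have hexp : Real.exp (-((4 * u) ^ 2 / 8)) = t ^ 2 := by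
        have hlog : 0 ≤ Real.log (1 / t) := Real.log_nonneg ((one_le_div ht).2 (by linarith))
        have : -((4 * u) ^ 2 / 8) = (2 : ℕ) * Real.log t := by
          rw [mul_pow, hu, Real.sq_sqrt hlog, one_div, Real.log_inv]
          push_cast
          ring
        rw [this, Real.exp_nat_mul, Real.exp_log ht]
      have hev : ∀ᶠ N : ℕ in atTop, cubeProb (fun σ =>
          2 * (120 * M') + 4 * weakK12 𝕜 x u < radNorm 𝕜 (fun i : Fin N => x i) σ) ≤ t := by
        filter_upwards [eventually_cubeProb_le hε hX (by positivity : 0 < 10 * M') (by norm_num)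
          hmarkov] with N hN
        have hav := cubeAvg_radNorm_le _ (by positivity) (hN.trans (by norm_num))
        have h1 := cubeProb_radNorm_gt_le (fun i : Fin N => x i) (M := 120 * M')
          (K := 4 * weakK12 𝕜 x u) (v := 4 * u) (by positivity) (by linarith)
          fun f hf z hz hz2 => (norm_sum_mul_le_K12 (hweak f) hu0 z hz hz2).trans
            (by linarith [hKle f hf])
        rw [hexp] at h1
        nlinarith
      have hfin := measureReal_norm_gt_le hε hX (by positivity) hev
      have hbelow : BddBelow {s : ℝ | 0 < s ∧ P.real {ω | s < ‖X ω‖} ≤ t} :=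
        ⟨0, fun s hs => hs.1.le⟩
      refine (csInf_le hbelow ⟨by positivity, hfin⟩).trans ?_
      rw [hM']
      linarith
    linarith
  · suffices h : (M + weakK12 𝕜 x u) / 480 ≤
        sInf {s : ℝ | 0 < s ∧ P.real {ω | s < ‖X ω‖} ≤ t} by linarith
    refine le_csInf ⟨s₀, hs₀, hPs₀⟩ ?_
    rintro s ⟨hs, h⟩
    have h1 := (integrable_norm_of_isASSum hε hX hs (h.trans ht')).2
    have h2 : weakK12 𝕜 x u ≤ 146 * s :=
      csSup_le ⟨_, 0, by simp, rfl⟩ (hKs s hs h)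
    linarith
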